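/- Let $(M,g)$ be an oriented smooth Riemannian $n$-manifold with Levi-Civita connection $\nabla$ and curvature $R(X,Y)=[\nabla_X,\nabla_Y]-\nabla_{[X,Y]}$. Let $G\subset SO(n)$ be either $U(n/2)$ with $n$ even, or $SO(m)\times SO(n-m)$ with $0\le m\le n$, let $\mathfrak g$ be its Lie algebra, and let $\mathfrak{so}(n)=\mathfrak g\oplus\mathfrak g^\perp$ be the decomposition orthogonal with respect to $\langle A,B\rangle=-\operatorname{tr}(AB)$. Let $P$ be a $G$-structure on $M$, that is, a reduction of the bundle $SO(M)$ of positively oriented orthonormal frames to $G$. The $\mathfrak g$-component of the Levi-Civita connection form is a connection form on $P$ and defines a connection $\nabla^G$ on $TM$; the intrinsic torsion of the $G$-structure is the tensor $\xi_XY=\nabla^G_XY-\nabla_XY$. Put $$\xi^{\rm alt}_XY=\tfrac12(\xi_XY-\xi_YX),\qquad \xi^{\rm sym}_XY=\tfrac12(\xi_XY+\xi_YX),\qquad \chi=\sum_i\xi_{e_i}e_i,$$ $$s_{\mathfrak g^\perp}=\sum_{i,j}g\big(R(e_i,e_j)_{\mathfrak g^\perp}e_j,e_i\big),$$ where $(e_i)$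 is any orthonormal basis of a tangent space and $R(X,Y)_{\mathfrak g^\perp}$ is the component of $R(X,Y)\in\mathfrak{so}(TM)$ in $\mathfrak g^\perp(TM)=P\times_{\mathrm{Ad}(G)}\mathfrak g^\perp$. For a $(1,2)$-tensor $T$ write $|T|^2=\sum_{i,j}|T_{e_i}e_j|^2$. (a) If the characteristic vector field $\chi$ vanishes on $M$, then at every point $$\tfrac12\,s_{\mathfrak g^\perp}=|\xi^{\rm alt}|^2-|\xi^{\rm sym}|^2 .$$ (b) If the intrinsic torsion is totally skew-symmetric (that is, $g(\xi_XY,Z)$ is a 3-form), then at every point $$s_{\mathfrak g^\perp}=2|\xi|^2\ge 0,$$ with equality at a point if and only if $\xi=0$ at that point; in particular $s_{\mathfrak g^\perp}$ vanishes identically on $M$ if and only if the $G$-structure is integrable, i.e. $\xi=0$. -/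

import Mathlib

open Bundle
open scoped Manifold ContDiff

namespace GStr

noncomputable section

/-! ### The Levi-Civita connection -/

section LeviCivita

variable {E : Type*} [NormedAddCommGroup E] [NormedSpace ℝ E]
  {H : Type*} [TopologicalSpace H] {I : ModelWithCorners ℝ E H}
  {M : Type*} [TopologicalSpace M] [ChartedSpace H M]

instance tangentSpace_finiteDimensional [FiniteDimensional ℝ E] (x : M) :
    FiniteDimensional ℝ (TangentSpace I x) :=
  inferInstanceAs (FiniteDimensional ℝ E)

section Koszul

variable [RiemannianBundle (fun x : M => TangentSpace I x)]

/-- The right-hand side of the Koszul formula, that is,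
`X g(Y,Z) + Y g(Z,X) - Z g(X,Y) + g([X,Y],Z) - g([Y,Z],X) + g([Z,X],Y)`. -/
def koszul (X Y Z : Π x : M, TangentSpace I x) (x : M) : ℝ :=
  d% (fun y => inner ℝ (Y y) (Z y)) x (X x) + d% (fun y => inner ℝ (Z y) (X y)) x (Y x)
    - d% (fun y => inner ℝ (X y) (Y y)) x (Z x)
    + inner ℝ (VectorField.mlieBracket I X Y x) (Z x)
    - inner ℝ (VectorField.mlieBracket I Y Z x) (X x)
    + inner ℝ (VectorField.mlieBracket I Z X x) (Y x)

variable [IsManifold I ∞ M] [IsContMDiffRiemannianBundle I ∞ E (fun x : M => TangentSpace I x)]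

theorem mdifferentiableAt_inner {X Y : Π x : M, TangentSpace I x} {x : M}
    (hX : MDiffAt (T% X) x) (hY : MDiffAt (T% Y) x) :
    MDiffAt (fun y => inner ℝ (X y) (Y y)) x :=
  MDifferentiableAt.inner_bundle (F := E) (E := fun x : M => TangentSpace I x) (b := id) hX hY

variable [FiniteDimensional ℝ E]

theorem koszul_tensorial_left {Y Z : Π x : M, TangentSpace I x} {x : M}
    (hY : MDiffAt (T% Y) x) (hZ : MDiffAt (T% Z) x) :
    TensorialAt I E (fun X => koszul X Y Z x) x where
  smul {f X} hf hX := by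
    simp [koszul, VectorField.mlieBracket_smul_left hf hX, VectorField.mlieBracket_smul_right hf hX,
      inner_smul_left, inner_smul_right, mvfderiv_fun_mul hf (mdifferentiableAt_inner hX hY),
      mvfderiv_fun_mul hf (mdifferentiableAt_inner hZ hX), inner_add_left]
    rw [real_inner_comm (X x) (Z x)]
    ring
  add {X X'} hX hX' := by
    simp [koszul, VectorField.mlieBracket_add_left hX hX', VectorField.mlieBracket_add_right hX hX',
      inner_add_left, inner_add_right,
      mvfderiv_fun_add (mdifferentiableAt_inner hX hY) (mdifferentiableAt_inner hX' hY),
      mvfderiv_fun_add (mdifferentiableAt_inner hZ hX) (mdifferentiableAt_inner hZ hX')]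
    ring

theorem koszul_tensorial_right {X Y : Π x : M, TangentSpace I x} {x : M}
    (hX : MDiffAt (T% X) x) (hY : MDiffAt (T% Y) x) :
    TensorialAt I E (fun Z => koszul X Y Z x) x where
  smul {f Z} hf hZ := by
    simp [koszul, VectorField.mlieBracket_smul_left hf hZ, VectorField.mlieBracket_smul_right hf hZ,
      inner_smul_left, inner_smul_right, mvfderiv_fun_mul hf (mdifferentiableAt_inner hZ hX),
      mvfderiv_fun_mul hf (mdifferentiableAt_inner hY hZ), inner_add_left]
    rw [real_inner_comm (X x) (Z x), real_inner_comm (Y x) (Z x)]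
    ring
  add {Z Z'} hZ hZ' := by
    simp [koszul, VectorField.mlieBracket_add_left hZ hZ', VectorField.mlieBracket_add_right hZ hZ',
      inner_add_left, inner_add_right,
      mvfderiv_fun_add (mdifferentiableAt_inner hZ hX) (mdifferentiableAt_inner hZ' hX),
      mvfderiv_fun_add (mdifferentiableAt_inner hY hZ) (mdifferentiableAt_inner hY hZ')]
    ring

theorem koszul_add {X Y Y' Z : Π x : M, TangentSpace I x} {x : M}
    (hX : MDiffAt (T% X) x) (hY : MDiffAt (T% Y) x) (hY' : MDiffAt (T% Y') x)
    (hZ : MDiffAt (T% Z) x) :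
    koszul X (Y + Y') Z x = koszul X Y Z x + koszul X Y' Z x := by
  simp [koszul, VectorField.mlieBracket_add_left hY hY', VectorField.mlieBracket_add_right hY hY',
      inner_add_left, inner_add_right,
      mvfderiv_fun_add (mdifferentiableAt_inner hY hZ) (mdifferentiableAt_inner hY' hZ),
      mvfderiv_fun_add (mdifferentiableAt_inner hX hY) (mdifferentiableAt_inner hX hY')]
  ring

theorem koszul_leibniz {X Y Z : Π x : M, TangentSpace I x} {f : M → ℝ} {x : M}
    (hX : MDiffAt (T% X) x) (hf : MDiffAt f x) (hY : MDiffAt (T% Y) x) (hZ : MDiffAt (T% Z) x) :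
    koszul X (f • Y) Z x
      = f x * koszul X Y Z x + 2 * (d% f x (X x) * inner ℝ (Y x) (Z x)) := by
  simp [koszul, VectorField.mlieBracket_smul_left hf hY, VectorField.mlieBracket_smul_right hf hY,
      inner_smul_left, inner_smul_right, mvfderiv_fun_mul hf (mdifferentiableAt_inner hY hZ),
      mvfderiv_fun_mul hf (mdifferentiableAt_inner hX hY), inner_add_left]
  rw [real_inner_comm (X x) (Y x)]
  ring

open Classical in
/-- The Levi-Civita operator: `∇_X Y` is the vector field with `2 g(∇_X Y, Z) = koszul X Y Z`
for all `Z`. As in Mathlib, the value at `(Y, x)` is the linear map `X ↦ ∇_X Y` on the tangent space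
at `x`. It is only meaningful where `Y` is differentiable. -/
def leviCivitaFun (Y : Π x : M, TangentSpace I x) (x : M) :
    TangentSpace I x →L[ℝ] TangentSpace I x :=
  if hY : MDiffAt (T% Y) x then
    ∑ i, ((1 / 2 : ℝ) • TensorialAt.mkHom
        (fun X => koszul X Y (FiberBundle.extend E (stdOrthonormalBasis ℝ (TangentSpace I x) i)) x) x
        (koszul_tensorial_left hY (FiberBundle.mdifferentiableAt_extend I E _))).smulRight
      (stdOrthonormalBasis ℝ (TangentSpace I x) i)
  else 0

theorem inner_leviCivitaFun {X Y Z : Π x : M, TangentSpace I x} {x : M}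
    (hX : MDiffAt (T% X) x) (hY : MDiffAt (T% Y) x) (hZ : MDiffAt (T% Z) x) :
    inner ℝ (leviCivitaFun Y x (X x)) (Z x) = (1 / 2) * koszul X Y Z x := by
  have hT := koszul_tensorial_right hX hY
  have key : ∀ v : TangentSpace I x, koszul X Y (FiberBundle.extend E v) x
      = TensorialAt.mkHom (fun Z => koszul X Y Z x) x hT v := fun v => rfl
  have h2 := TensorialAt.mkHom_apply hT hZ
  rw [leviCivitaFun, dif_pos hY]
  simp only [_root_.sum_apply, ContinuousLinearMap.smulRight_apply,
    _root_.smul_apply, sum_inner, inner_smul_left]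
  rw [← h2]
  conv_rhs => rw [← (stdOrthonormalBasis ℝ (TangentSpace I x)).sum_repr' (Z x)]
  rw [map_sum, Finset.mul_sum]
  refine Finset.sum_congr rfl fun i _ => ?_
  rw [TensorialAt.mkHom_apply _ hX, (TensorialAt.mkHom _ x hT).map_smul, ← key]
  simp
  ring

/-- The Levi-Civita connection of a Riemannian manifold. -/
def leviCivita : CovariantDerivative I E (TangentSpace I : M → Type _) where
  toFun := leviCivitaFun
  isCovariantDerivativeOnUniv :=
    { add := by
        intro σ σ' x hσ hσ' _
        ext X₀
        refine ext_inner_right ℝ fun Z₀ => ?_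
        have hX := FiberBundle.mdifferentiableAt_extend I E X₀
        have hZ := FiberBundle.mdifferentiableAt_extend I E Z₀
        rw [← FiberBundle.extend_apply_self E X₀, ← FiberBundle.extend_apply_self E Z₀,
          inner_leviCivitaFun hX (mdifferentiableAt_add_section hσ hσ') hZ,
          koszul_add hX hσ hσ' hZ, _root_.add_apply, inner_add_left,
          inner_leviCivitaFun hX hσ hZ, inner_leviCivitaFun hX hσ' hZ]
        ring
      leibniz := by
        intro σ f x hσ hf _
        ext X₀
        refine ext_inner_right ℝ fun Z₀ => ?_
        have hX := FiberBundle.mdifferentiableAt_extend I E X₀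
        have hZ := FiberBundle.mdifferentiableAt_extend I E Z₀
        rw [← FiberBundle.extend_apply_self E X₀, ← FiberBundle.extend_apply_self E Z₀,
          inner_leviCivitaFun hX (hf.smul_section hσ) hZ,
          koszul_leibniz hX hf hσ hZ, _root_.add_apply, inner_add_left,
          _root_.smul_apply, inner_smul_left, inner_leviCivitaFun hX hσ hZ,
          ContinuousLinearMap.smulRight_apply, inner_smul_left]
        simp
        ring }

theorem inner_leviCivita {X Y Z : Π x : M, TangentSpace I x} {x : M}
    (hX : MDiffAt (T% X) x) (hY : MDiffAt (T% Y) x) (hZ : MDiffAt (T% Z) x) :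
    inner ℝ (leviCivita Y x (X x)) (Z x) = (1 / 2) * koszul X Y Z x :=
  inner_leviCivitaFun hX hY hZ

/-- The Levi-Civita connection is torsion free. -/
theorem leviCivita_torsion :
    (leviCivita : CovariantDerivative I E (TangentSpace I : M → Type _)).torsion = 0 := by
  rw [CovariantDerivative.torsion_eq_zero_iff]
  intro X Y x hX hY
  refine ext_inner_right ℝ fun Z₀ => ?_
  have hZ := FiberBundle.mdifferentiableAt_extend I E Z₀
  rw [← FiberBundle.extend_apply_self E Z₀, inner_sub_left, inner_leviCivita hX hY hZ,
    inner_leviCivita hY hX hZ]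
  set Z := FiberBundle.extend E Z₀
  simp only [koszul]
  rw [VectorField.mlieBracket_swap_apply (V := Y) (W := X),
    VectorField.mlieBracket_swap_apply (V := X) (W := Z),
    VectorField.mlieBracket_swap_apply (V := Y) (W := Z)]
  simp only [inner_neg_left, real_inner_comm]
  ring

/-- The Levi-Civita connection is compatible with the metric. -/
theorem leviCivita_metric {X Y Z : Π x : M, TangentSpace I x} {x : M}
    (hX : MDiffAt (T% X) x) (hY : MDiffAt (T% Y) x) (hZ : MDiffAt (T% Z) x) :
    d% (fun y => inner ℝ (Y y) (Z y)) x (X x)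
      = inner ℝ (leviCivita Y x (X x)) (Z x) + inner ℝ (Y x) (leviCivita Z x (X x)) := by
  rw [real_inner_comm _ (Y x), inner_leviCivita hX hY hZ, inner_leviCivita hX hZ hY]
  simp only [koszul]
  rw [VectorField.mlieBracket_swap_apply (V := Y) (W := X),
    VectorField.mlieBracket_swap_apply (V := X) (W := Z),
    VectorField.mlieBracket_swap_apply (V := Z) (W := Y)]
  simp only [inner_neg_left, real_inner_comm]
  ring

end Koszul

/-- The curvature `R(X,Y)Z = ∇_X ∇_Y Z - ∇_Y ∇_X Z - ∇_{[X,Y]} Z`. -/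
def curvatureField [IsManifold I ∞ M]
    (D : CovariantDerivative I E (TangentSpace I : M → Type _))
    (X Y Z : Π x : M, TangentSpace I x) (x : M) :
    TangentSpace I x :=
  D (fun y => D Z y (Y y)) x (X x) - D (fun y => D Z y (X y)) x (Y x)
    - D Z x (VectorField.mlieBracket I X Y x)

/-- The value `R(X,Y)Z` of the curvature tensor on tangent vectors at `x`, computed with the
smooth local extensions `FiberBundle.extend` of the three vectors. -/
def curvature [IsManifold I ∞ M] (D : CovariantDerivative I E (TangentSpace I : M → Type _))
    (x : M) (X Y Z : TangentSpace I x) : TangentSpace I x :=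
  curvatureField D (FiberBundle.extend E X) (FiberBundle.extend E Y) (FiberBundle.extend E Z) x

end LeviCivita

/-! ### Subgroups of `SO(n)` and their Lie algebras -/

section Groups

open Matrix

variable {n : ℕ}

/-- `SO(n)`. -/
abbrev SO (n : ℕ) := Matrix.specialOrthogonalGroup (Fin n) ℝ

/-- The Lie algebra of a closed subgroup `G` of `SO(n)`: the matrices `A` with `exp (t A) ∈ G` for
all real `t`. (For closed `G` these form a linear subspace, so that taking the span adds nothing.) -/
def lieAlgebra (G : Subgroup (SO n)) : Submodule ℝ (Matrix (Fin n) (Fin n) ℝ) :=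
  Submodule.span ℝ {A | ∀ t : ℝ, ∃ a ∈ G, (a : Matrix (Fin n) (Fin n) ℝ) = NormedSpace.exp (t • A)}

/-- Matrices as a Euclidean space, with the inner product `⟨A, B⟩ = tr (Aᵀ B)`. On `so(n)` this is
`- tr (A B)`, a multiple of the Killing form. -/
def matrixEuclidean (n : ℕ) :
    Matrix (Fin n) (Fin n) ℝ ≃ₗ[ℝ] EuclideanSpace ℝ (Fin n × Fin n) :=
  (LinearEquiv.curry ℝ ℝ (Fin n) (Fin n)).symm.trans (WithLp.linearEquiv 2 ℝ _).symm

theorem inner_matrixEuclidean (A B : Matrix (Fin n) (Fin n) ℝ) :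
    inner ℝ (matrixEuclidean n A) (matrixEuclidean n B) = (Aᵀ * B).trace := by
  simp only [PiLp.inner_apply, Matrix.trace, Matrix.diag_apply, Matrix.mul_apply,
    Fintype.sum_prod_type]
  rw [Finset.sum_comm]
  refine Finset.sum_congr rfl fun i _ => Finset.sum_congr rfl fun j _ => ?_
  simp only [RCLike.inner_apply, conj_trivial, Matrix.transpose_apply]
  exact mul_comm (B j i) (A j i)

/-- The orthogonal projection `A ↦ A_𝔤` onto the Lie algebra of `G`. -/
def projLie (G : Subgroup (SO n)) :
    Matrix (Fin n) (Fin n) ℝ →ₗ[ℝ] Matrix (Fin n) (Fin n) ℝ :=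
  (matrixEuclidean n).symm.toLinearMap ∘ₗ
    ((lieAlgebra G).map (matrixEuclidean n).toLinearMap).starProjection.toLinearMap ∘ₗ
    (matrixEuclidean n).toLinearMap

theorem projLie_mem (G : Subgroup (SO n)) (A : Matrix (Fin n) (Fin n) ℝ) :
    projLie G A ∈ lieAlgebra G := by
  have h := Submodule.starProjection_apply_mem
    ((lieAlgebra G).map (matrixEuclidean n).toLinearMap) (matrixEuclidean n A)
  obtain ⟨B, hB, hBA⟩ := h
  have : projLie G A = B := by
    simp only [projLie, LinearMap.comp_apply]
    erw [← hBA]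
    simp
  rwa [this]

theorem trace_sub_projLie (G : Subgroup (SO n)) (A : Matrix (Fin n) (Fin n) ℝ)
    {B : Matrix (Fin n) (Fin n) ℝ} (hB : B ∈ lieAlgebra G) :
    ((A - projLie G A)ᵀ * B).trace = 0 := by
  rw [← inner_matrixEuclidean, map_sub]
  have : matrixEuclidean n (projLie G A) = ((lieAlgebra G).map
      (matrixEuclidean n).toLinearMap).starProjection (matrixEuclidean n A) := by
    simp [projLie]
  rw [this]
  exact Submodule.starProjection_inner_eq_zero _ _ (Submodule.mem_map_of_mem hB)

/-- The component `A ↦ A_{𝔤⊥} = A - A_𝔤` of `A ∈ so(n) = 𝔤 ⊕ 𝔤⊥`. -/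
def projPerp (G : Subgroup (SO n)) :
    Matrix (Fin n) (Fin n) ℝ →ₗ[ℝ] Matrix (Fin n) (Fin n) ℝ :=
  LinearMap.id - projLie G

/-- The standard complex structure with blocks `(0, -1; 1, 0)` on `ℝⁿ`, `n = 2 k`. -/
def stdJ {k : ℕ} (h : k + k = n) : Matrix (Fin n) (Fin n) ℝ :=
  Matrix.reindex (finSumFinEquiv.trans (finCongr h)) (finSumFinEquiv.trans (finCongr h))
    (Matrix.fromBlocks 0 (-1) 1 0)

/-- The unitary group `U(n/2)` as a subgroup of `SO(n)`, `n = 2 k`: the elements commuting with the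
standard complex structure. -/
def unitarySubgroup {k : ℕ} (h : k + k = n) : Subgroup (SO n) where
  carrier := {a | (a : Matrix (Fin n) (Fin n) ℝ) * stdJ h = stdJ h * a}
  one_mem' := by simp
  mul_mem' {a b} ha hb := by
    simp only [Set.mem_ofPred_eq, Submonoid.coe_mul] at *
    rw [mul_assoc, hb, ← mul_assoc, ha, mul_assoc]
  inv_mem' {a} ha := by
    simp only [Set.mem_ofPred_eq] at *
    have h1 : ((a⁻¹ : SO n) : Matrix (Fin n) (Fin n) ℝ) * a = 1 :=
      congrArg Subtype.val (inv_mul_cancel a)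
    have h2 : (a : Matrix (Fin n) (Fin n) ℝ) * (a⁻¹ : SO n) = 1 :=
      congrArg Subtype.val (mul_inv_cancel a)
    calc ((a⁻¹ : SO n) : Matrix (Fin n) (Fin n) ℝ) * stdJ h
        = (a⁻¹ : SO n) * (stdJ h * a) * (a⁻¹ : SO n) := by
          rw [mul_assoc, mul_assoc, h2, mul_one]
      _ = stdJ h * (a⁻¹ : SO n) := by
          rw [← ha, ← mul_assoc, h1, one_mul]

/-- The block diagonal matrix with diagonal blocks `A` and `B`, of size `n = m + l`. -/
def blockDiag {m l : ℕ} (h : m + l = n) (A : Matrix (Fin m) (Fin m) ℝ)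
    (B : Matrix (Fin l) (Fin l) ℝ) : Matrix (Fin n) (Fin n) ℝ :=
  Matrix.reindex (finSumFinEquiv.trans (finCongr h)) (finSumFinEquiv.trans (finCongr h))
    (Matrix.fromBlocks A 0 0 B)

theorem blockDiag_mul {m l : ℕ} (h : m + l = n) (A A' : Matrix (Fin m) (Fin m) ℝ)
    (B B' : Matrix (Fin l) (Fin l) ℝ) :
    blockDiag h A B * blockDiag h A' B' = blockDiag h (A * A') (B * B') := by
  simp only [blockDiag, Matrix.reindex_apply, Matrix.submatrix_mul_equiv, Matrix.fromBlocks_multiply]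
  simp

theorem blockDiag_one {m l : ℕ} (h : m + l = n) :
    blockDiag h (1 : Matrix (Fin m) (Fin m) ℝ) (1 : Matrix (Fin l) (Fin l) ℝ) = 1 := by
  simp only [blockDiag, Matrix.reindex_apply, Matrix.fromBlocks_one, Matrix.submatrix_one_equiv]

/-- The subgroup `SO(m) × SO(l)` of `SO(n)`, `n = m + l`, of block diagonal matrices. -/
def productSubgroup {m l : ℕ} (h : m + l = n) : Subgroup (SO n) where
  carrier := {a | ∃ (A : SO m) (B : SO l), (a : Matrix (Fin n) (Fin n) ℝ) = blockDiag h A B}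
  one_mem' := ⟨1, 1, by simp [blockDiag_one]⟩
  mul_mem' {a b} ha hb := by
    obtain ⟨A, B, h1⟩ := ha
    obtain ⟨A', B', h2⟩ := hb
    exact ⟨A * A', B * B', by simp [h1, h2, blockDiag_mul]⟩
  inv_mem' {a} ha := by
    obtain ⟨A, B, h1⟩ := ha
    refine ⟨A⁻¹, B⁻¹, ?_⟩
    have h2 : (a : Matrix (Fin n) (Fin n) ℝ) * (a⁻¹ : SO n) = 1 :=
      congrArg Subtype.val (mul_inv_cancel a)
    have hA : ((A⁻¹ : SO m) : Matrix (Fin m) (Fin m) ℝ) * A = 1 :=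
      congrArg Subtype.val (inv_mul_cancel A)
    have hB : ((B⁻¹ : SO l) : Matrix (Fin l) (Fin l) ℝ) * B = 1 :=
      congrArg Subtype.val (inv_mul_cancel B)
    calc ((a⁻¹ : SO n) : Matrix (Fin n) (Fin n) ℝ)
        = blockDiag h (A⁻¹ : SO m) (B⁻¹ : SO l) * a * (a⁻¹ : SO n) := by
          rw [h1, blockDiag_mul, hA, hB, blockDiag_one, one_mul]
      _ = blockDiag h (A⁻¹ : SO m) (B⁻¹ : SO l) := by rw [mul_assoc, h2, mul_one]

end Groups

/-! ### `G`-structures, the connection `∇^G` and the intrinsic torsion -/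

section Structures

/-- An orientation of an `n`-manifold: an orientation of each tangent space which near every point
is the one of a continuous frame. -/
structure ManifoldOrientation (n : ℕ) (M : Type*) [TopologicalSpace M]
    [ChartedSpace (EuclideanSpace ℝ (Fin n)) M] [IsManifold (𝓡 n) ∞ M] where
  orient : ∀ x : M, Orientation ℝ (TangentSpace (𝓡 n) x) (Fin n)
  locally_continuous : ∀ x : M, ∃ U : Set M, IsOpen U ∧ x ∈ U ∧
    ∃ b : ∀ y : M, Module.Basis (Fin n) ℝ (TangentSpace (𝓡 n) y),
      (∀ y ∈ U, (b y).orientation = orient y) ∧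
      ∀ i, ContinuousOn (fun y => (⟨y, b y i⟩ : TangentBundle (𝓡 n) M)) U

variable {n : ℕ} {M : Type*} [TopologicalSpace M] [ChartedSpace (EuclideanSpace ℝ (Fin n)) M]
  [IsManifold (𝓡 n) ∞ M] [RiemannianBundle (fun x : M => TangentSpace (𝓡 n) x)]

/-- A `G`-structure, `G ⊆ SO(n)`, on an oriented Riemannian `n`-manifold: a reduction `P` of the
bundle `SO(M)` of positively oriented orthonormal frames to `G`. It consists of a set of positively
oriented orthonormal frames at each point, which is an orbit for the right action
`(u · a)_j = ∑ i, a i j • u_i` of `G`, and which near each point has a smooth section. -/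
structure GStructure (o : ManifoldOrientation n M) (G : Subgroup (SO n)) where
  frames : ∀ x : M, Set (OrthonormalBasis (Fin n) ℝ (TangentSpace (𝓡 n) x))
  oriented : ∀ x, ∀ u ∈ frames x, u.toBasis.orientation = o.orient x
  orbit : ∀ x, ∀ u ∈ frames x, ∀ v : OrthonormalBasis (Fin n) ℝ (TangentSpace (𝓡 n) x),
    v ∈ frames x ↔ ∃ a ∈ G, ∀ j, v j = ∑ i, (a : Matrix (Fin n) (Fin n) ℝ) i j • u i
  exists_section : ∀ x : M, ∃ s : ∀ y : M, OrthonormalBasis (Fin n) ℝ (TangentSpace (𝓡 n) y),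
    ∃ U : Set M, IsOpen U ∧ x ∈ U ∧ (∀ y ∈ U, s y ∈ frames y) ∧
      ∀ i, ContMDiffOn (𝓡 n) ((𝓡 n).prod 𝓘(ℝ, EuclideanSpace ℝ (Fin n))) ∞
        (fun y => (⟨y, s y i⟩ : TangentBundle (𝓡 n) M)) U

namespace GStructure

variable {o : ManifoldOrientation n M} {G : Subgroup (SO n)} (P : GStructure o G)

/-- A local section of the frame bundle `P`, smooth near `x`. -/
def localFrame (x : M) : ∀ y : M, OrthonormalBasis (Fin n) ℝ (TangentSpace (𝓡 n) y) :=
  (P.exists_section x).choose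

theorem localFrame_spec (x : M) : ∃ U : Set M, IsOpen U ∧ x ∈ U ∧
    (∀ y ∈ U, P.localFrame x y ∈ P.frames y) ∧
      ∀ i, ContMDiffOn (𝓡 n) ((𝓡 n).prod 𝓘(ℝ, EuclideanSpace ℝ (Fin n))) ∞
        (fun y => (⟨y, P.localFrame x y i⟩ : TangentBundle (𝓡 n) M)) U :=
  (P.exists_section x).choose_spec

theorem mdifferentiableAt_localFrame (x : M) (i : Fin n) :
    MDifferentiableAt (𝓡 n) ((𝓡 n).prod 𝓘(ℝ, EuclideanSpace ℝ (Fin n)))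
      (fun y => (⟨y, P.localFrame x y i⟩ : TangentBundle (𝓡 n) M)) x := by
  obtain ⟨U, hU, hx, -, h⟩ := P.localFrame_spec x
  exact ((h i).contMDiffAt (hU.mem_nhds hx)).mdifferentiableAt (by simp)

end GStructure

/-- The squared norm `|T|² = ∑ i j, |T(e_i, e_j)|²` of a `(1,2)`-tensor, `(e_i)` orthonormal. -/
def normSq {x : M} (T : TangentSpace (𝓡 n) x → TangentSpace (𝓡 n) x → TangentSpace (𝓡 n) x) : ℝ :=
  ∑ i, ∑ j, ‖T (stdOrthonormalBasis ℝ (TangentSpace (𝓡 n) x) i)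
    (stdOrthonormalBasis ℝ (TangentSpace (𝓡 n) x) j)‖ ^ 2

variable [IsContMDiffRiemannianBundle (𝓡 n) ∞ (EuclideanSpace ℝ (Fin n))
  (fun x : M => TangentSpace (𝓡 n) x)]

/-- The Levi-Civita connection form `ω` in a local orthonormal frame `s`: the matrix with
`∇_X s_j = ∑ i, ω(X) i j • s_i`. -/
def connectionForm (s : ∀ y : M, OrthonormalBasis (Fin n) ℝ (TangentSpace (𝓡 n) y)) (x : M) :
    TangentSpace (𝓡 n) x →ₗ[ℝ] Matrix (Fin n) (Fin n) ℝ where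
  toFun X := Matrix.of fun i j => inner ℝ (s x i) (leviCivita (fun y => s y j) x X)
  map_add' X Y := by ext i j; simp [inner_add_right]
  map_smul' c X := by ext i j; simp [inner_smul_right]

namespace GStructure

variable {o : ManifoldOrientation n M} {G : Subgroup (SO n)} (P : GStructure o G)

/-- The entries of the `𝔤`-component `ω_𝔤` of the connection form at `x`, in the chosen section. -/
def connectionCoeff (x : M) (i j : Fin n) : TangentSpace (𝓡 n) x →L[ℝ] ℝ :=
  LinearMap.toContinuousLinearMap
    { toFun := fun X => projLie G (connectionForm (P.localFrame x) x X) i j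
      map_add' := fun X Y => by simp
      map_smul' := fun c X => by simp }

/-- The connection `∇^G` on `TM` with connection form `ω_𝔤`: if `Y = ∑ j, Y^j s_j` for a section
`s` of `P`, then `∇^G_X Y = ∑ i, (X(Y^i) + ∑ j, ω_𝔤(X) i j * Y^j) s_i`. -/
def gConnection :
    CovariantDerivative (𝓡 n) (EuclideanSpace ℝ (Fin n)) (TangentSpace (𝓡 n) : M → Type _) where
  toFun Y x := ∑ i,
    (mvfderiv (𝓡 n) (fun y => inner ℝ (P.localFrame x y i) (Y y)) x
      + ∑ j, inner ℝ (P.localFrame x x j) (Y x) • P.connectionCoeff x i j).smulRight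
        (P.localFrame x x i)
  isCovariantDerivativeOnUniv :=
    { add := by
        intro σ σ' x hσ hσ' _
        ext X
        have hs := P.mdifferentiableAt_localFrame x
        simp [inner_add_right, mvfderiv_fun_add (mdifferentiableAt_inner (hs _) hσ)
          (mdifferentiableAt_inner (hs _) hσ'), Finset.sum_add_distrib, add_smul]
        abel
      leibniz := by
        intro σ f x hσ hf _
        ext X
        have hs := P.mdifferentiableAt_localFrame x
        have h0 : ∑ i, inner ℝ (P.localFrame x x i) (σ x) • (mvfderiv (𝓡 n) f x X) • P.localFrame x x i
            = (mvfderiv (𝓡 n) f x X) • σ x := by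
          simp only [smul_comm (inner ℝ _ _ : ℝ) (mvfderiv (𝓡 n) f x X)]
          rw [← Finset.smul_sum, (P.localFrame x x).sum_repr' (σ x)]
        simp [inner_smul_right, mvfderiv_fun_mul hf (mdifferentiableAt_inner (hs _) hσ),
          Finset.sum_add_distrib, add_smul, ← Finset.mul_sum, Finset.smul_sum,
          mul_smul, ← h0]
        abel }

/-- The intrinsic torsion `ξ_X Y = ∇^G_X Y - ∇_X Y`. -/
def intrinsicTorsion (x : M) (X Y : TangentSpace (𝓡 n) x) : TangentSpace (𝓡 n) x :=
  P.gConnection.difference leviCivita x Y X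

theorem intrinsicTorsion_apply {x : M} (X : TangentSpace (𝓡 n) x)
    {Y : Π x : M, TangentSpace (𝓡 n) x} (hY : MDifferentiableAt (𝓡 n) ((𝓡 n).prod 𝓘(ℝ, EuclideanSpace ℝ (Fin n)))
      (fun y => (⟨y, Y y⟩ : TangentBundle (𝓡 n) M)) x) :
    P.intrinsicTorsion x X (Y x) = P.gConnection Y x X - leviCivita Y x X := by
  simp only [intrinsicTorsion, CovariantDerivative.difference]
  rw [IsCovariantDerivativeOn.difference_apply _ _ (Set.mem_univ x) hY]
  rfl

/-- The skew-symmetric part `ξ^alt_X Y = (ξ_X Y - ξ_Y X) / 2`. -/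
def torsionAlt (x : M) (X Y : TangentSpace (𝓡 n) x) : TangentSpace (𝓡 n) x :=
  (1 / 2 : ℝ) • (P.intrinsicTorsion x X Y - P.intrinsicTorsion x Y X)

/-- The symmetric part `ξ^sym_X Y = (ξ_X Y + ξ_Y X) / 2`. -/
def torsionSym (x : M) (X Y : TangentSpace (𝓡 n) x) : TangentSpace (𝓡 n) x :=
  (1 / 2 : ℝ) • (P.intrinsicTorsion x X Y + P.intrinsicTorsion x Y X)

/-- The characteristic vector field `χ = ∑ i, ξ_{e_i} e_i`, `(e_i)` orthonormal. -/
def charField (x : M) : TangentSpace (𝓡 n) x :=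
  ∑ i, P.intrinsicTorsion x (stdOrthonormalBasis ℝ (TangentSpace (𝓡 n) x) i)
    (stdOrthonormalBasis ℝ (TangentSpace (𝓡 n) x) i)

/-- The component of an endomorphism `F ∈ so(T_x M)` in `𝔤⊥(T_x M) = u 𝔤⊥ u⁻¹`, where `u` is a frame
in `P` at `x`. -/
def perpComponent (x : M) (F : TangentSpace (𝓡 n) x → TangentSpace (𝓡 n) x) :
    TangentSpace (𝓡 n) x →ₗ[ℝ] TangentSpace (𝓡 n) x :=
  Matrix.toLin (P.localFrame x x).toBasis (P.localFrame x x).toBasis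
    (projPerp G (Matrix.of fun i j => inner ℝ (P.localFrame x x i) (F (P.localFrame x x j))))

/-- The `𝔤⊥`-component of the scalar curvature,
`s_{𝔤⊥} = ∑ i j, g(R(e_i, e_j)_{𝔤⊥} e_j, e_i)`, `(e_i)` orthonormal. -/
def scalarPerp (x : M) : ℝ :=
  ∑ i, ∑ j, inner ℝ
    (P.perpComponent x (curvature leviCivita x (stdOrthonormalBasis ℝ (TangentSpace (𝓡 n) x) i)
        (stdOrthonormalBasis ℝ (TangentSpace (𝓡 n) x) j))
      (stdOrthonormalBasis ℝ (TangentSpace (𝓡 n) x) j))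
    (stdOrthonormalBasis ℝ (TangentSpace (𝓡 n) x) i)

/-- `ξ` is totally skew-symmetric: `(X, Y, Z) ↦ g(ξ_X Y, Z)` is a 3-form. -/
def IsTotallySkew : Prop :=
  ∀ (x : M) (X Y Z : TangentSpace (𝓡 n) x),
    inner ℝ (P.intrinsicTorsion x X Y) Z = - inner ℝ (P.intrinsicTorsion x Y X) Z ∧
    inner ℝ (P.intrinsicTorsion x X Y) Z = - inner ℝ (P.intrinsicTorsion x X Z) Y

/-- The `G`-structure is integrable, that is, `ξ = 0`. -/
def IsIntegrable : Prop :=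
  ∀ (x : M) (X Y : TangentSpace (𝓡 n) x), P.intrinsicTorsion x X Y = 0

end GStructure

end Structures

end

end GStr

namespace GStr

noncomputable section

/-! ### Symmetric pairs: 𝔤 and 𝔤⊥ as eigenspaces of conjugation by `K`. -/

section SymmetricPairs

open Matrix

variable {n : ℕ}

/-! Both families of groups are, up to components, centralisers in `SO(n)` of an orthogonal matrix
`K` with `K² = ε = ±1`: the complex structure, or `diag(1, -1)`. Hence 𝔤 and 𝔤⊥ are the `+1` and
`-1` eigenspaces of the involution `A ↦ ε K A K` of `so(n)`, and `[𝔤, 𝔤⊥] ⊆ 𝔤⊥` while `[𝔤⊥, 𝔤⊥] ⊆ 𝔤`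
(`projPerp_commutator`). This is the only property of `G` that matters.

Along a local section `s` of `P` write the Levi-Civita form as `ω = α + β` with `α` in 𝔤 and `β` in
𝔤⊥. Then `ξ = -β`, and the 𝔤⊥-part of `Ω = dω + ω ∧ ω` is `dβ` plus the brackets of `α` with `β`,
with no term quadratic in `β` besides the one hidden in `dβ` through `[s_i, s_j] = ∇_{s_i} s_j -
∇_{s_j} s_i`. In the double contraction defining `s_{𝔤⊥}` the derivative terms become derivatives of
the components of `χ`, which vanish since `χ = 0` near the point. The mixed `αβ` terms cancel, and
`-2 ∑ β_i(k,j) β_k(i,j)` remains (`sum_projPerp_curvature`). By polarisation `|ξ^alt|² - |ξ^sym|²`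
is half of this, which is (a). For (b), total skewness gives `χ = 0`, `ξ^sym = 0` and `ξ^alt = ξ`.

The geometric input is the structure equation (`inner_frame_curvature`) and the fact that `β` is
tensorial under changes of section of `P` (`projPerp_frameForm_change`). The latter lets `χ` be
computed in one fixed section on a whole neighbourhood and then differentiated. -/

theorem eq_of_forall_exp_smul_eq {A B : Matrix (Fin n) (Fin n) ℝ}
    (h : ∀ t : ℝ, NormedSpace.exp (t • A) = NormedSpace.exp (t • B)) : A = B := by
  -- A norm on matrices is chosen locally, only to differentiate `exp (t A)` at `t = 0`, where the
  -- derivative is `A`.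
  let _ : NormedRing (Matrix (Fin n) (Fin n) ℝ) := Matrix.linftyOpNormedRing
  let _ : NormedAlgebra ℝ (Matrix (Fin n) (Fin n) ℝ) := Matrix.linftyOpNormedAlgebra
  have hA := hasDerivAt_exp_smul_const (𝕂 := ℝ) A (0 : ℝ)
  have hB := hasDerivAt_exp_smul_const (𝕂 := ℝ) B (0 : ℝ)
  simpa using hA.unique (hB.congr_of_eventuallyEq (Filter.Eventually.of_forall h))

theorem commute_of_forall_commute_exp_smul {A K : Matrix (Fin n) (Fin n) ℝ}
    (h : ∀ t : ℝ, NormedSpace.exp (t • A) * K = K * NormedSpace.exp (t • A)) : A * K = K * A := by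
  let _ : NormedRing (Matrix (Fin n) (Fin n) ℝ) := Matrix.linftyOpNormedRing
  let _ : NormedAlgebra ℝ (Matrix (Fin n) (Fin n) ℝ) := Matrix.linftyOpNormedAlgebra
  have hA := hasDerivAt_exp_smul_const (𝕂 := ℝ) A (0 : ℝ)
  have h1 := hA.mul_const K
  have h2 := hA.const_mul K
  simpa using h1.unique (h2.congr_of_eventuallyEq (Filter.Eventually.of_forall h))

theorem exp_commute_of_commute {A K : Matrix (Fin n) (Fin n) ℝ} (h : A * K = K * A) :
    NormedSpace.exp A * K = K * NormedSpace.exp A := by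
  let _ : NormedRing (Matrix (Fin n) (Fin n) ℝ) := Matrix.linftyOpNormedRing
  let _ : NormedAlgebra ℝ (Matrix (Fin n) (Fin n) ℝ) := Matrix.linftyOpNormedAlgebra
  let _ : NormedAlgebra ℚ (Matrix (Fin n) (Fin n) ℝ) := NormedAlgebra.restrictScalars ℚ ℝ _
  exact (show Commute A K from h).exp_left

theorem transpose_mul_self_coe (a : SO n) :
    (a : Matrix (Fin n) (Fin n) ℝ)ᵀ * (a : Matrix (Fin n) (Fin n) ℝ) = 1 := by
  have := (Matrix.mem_specialOrthogonalGroup_iff.1 a.2).1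
  simpa [Matrix.star_eq_conjTranspose] using (Matrix.mem_orthogonalGroup_iff' (Fin n) ℝ).1 this

/-- `K` realises `G` as the symmetric subgroup of an involution of `SO(n)`: it is orthogonal with
`K² = ± 1`, all of `G` commutes with it, and `G` contains the square of every orthogonal matrix
commuting with `K`. -/
structure IsSymmetricPair (G : Subgroup (SO n)) (K : Matrix (Fin n) (Fin n) ℝ) (ε : ℝ) : Prop where
  sq_eq_one : ε * ε = 1
  mul_self : K * K = ε • 1
  transpose_eq : Kᵀ = ε • K
  commute : ∀ a ∈ G, (a : Matrix (Fin n) (Fin n) ℝ) * K = K * a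
  exists_sq : ∀ b : Matrix (Fin n) (Fin n) ℝ, bᵀ * b = 1 → b * K = K * b →
    ∃ a ∈ G, (a : Matrix (Fin n) (Fin n) ℝ) = b * b

/-- Squaring kills the sign of the determinant. For this reason `IsSymmetricPair` speaks of squares:
the centraliser of `diag(1, -1)` in `O(n)` is `O(m) × O(l)`, whose elements may have blocks of
determinant `-1`. -/
theorem mul_self_mem_specialOrthogonalGroup {ι : Type*} [Fintype ι] [DecidableEq ι]
    {b : Matrix ι ι ℝ} (hb : bᵀ * b = 1) : b * b ∈ Matrix.specialOrthogonalGroup ι ℝ := by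
  rw [Matrix.mem_specialOrthogonalGroup_iff]
  have h : b ∈ Matrix.orthogonalGroup ι ℝ := by
    rw [Matrix.mem_orthogonalGroup_iff']
    simpa [Matrix.star_eq_conjTranspose] using hb
  refine ⟨mul_mem h h, ?_⟩
  have := congrArg Matrix.det hb
  simpa using this

theorem isSymmetricPair_unitarySubgroup {k : ℕ} (h : k + k = n) :
    IsSymmetricPair (unitarySubgroup h) (stdJ h) (-1) where
  sq_eq_one := by norm_num
  mul_self := by
    rw [stdJ, Matrix.reindex_apply, Matrix.submatrix_mul_equiv, Matrix.fromBlocks_multiply]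
    have h1 : Matrix.fromBlocks (0 * 0 + -1 * 1) (0 * -1 + -1 * 0) (1 * 0 + 0 * 1) (1 * -1 + 0 * 0)
        = (-1 : Matrix (Fin k ⊕ Fin k) (Fin k ⊕ Fin k) ℝ) := by
      rw [← Matrix.fromBlocks_one, Matrix.fromBlocks_neg]
      simp
    rw [h1, ← neg_one_smul ℝ (1 : Matrix (Fin k ⊕ Fin k) (Fin k ⊕ Fin k) ℝ),
      Matrix.submatrix_smul]
    simp only [Pi.smul_apply, Matrix.submatrix_one_equiv]
  transpose_eq := by
    rw [stdJ, Matrix.reindex_apply, Matrix.transpose_submatrix, Matrix.fromBlocks_transpose]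
    have h1 : Matrix.fromBlocks 0ᵀ 1ᵀ (-1)ᵀ 0ᵀ
        = (-1 : ℝ) • (Matrix.fromBlocks 0 (-1) 1 0 : Matrix (Fin k ⊕ Fin k) (Fin k ⊕ Fin k) ℝ) := by
      rw [Matrix.fromBlocks_smul]
      simp
    rw [h1, Matrix.submatrix_smul]
    rfl
  commute a ha := ha
  exists_sq b hb hK := ⟨⟨b * b, mul_self_mem_specialOrthogonalGroup hb⟩, by
    change b * b * stdJ h = stdJ h * (b * b)
    rw [mul_assoc, hK, ← mul_assoc, hK, mul_assoc], rfl⟩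

theorem isSymmetricPair_productSubgroup {m l : ℕ} (h : m + l = n) :
    IsSymmetricPair (productSubgroup h) (blockDiag h 1 (-1)) 1 where
  sq_eq_one := by norm_num
  mul_self := by rw [blockDiag_mul]; simp [blockDiag_one]
  transpose_eq := by
    simp [blockDiag, Matrix.reindex_apply, Matrix.fromBlocks_transpose]
  commute := by
    rintro a ⟨A, B, hab⟩
    rw [hab, blockDiag_mul, blockDiag_mul]
    simp
  exists_sq b hb hK := by
    set e := finSumFinEquiv.trans (finCongr h) with he
    obtain ⟨B₁₁, B₁₂, B₂₁, B₂₂, rfl⟩ : ∃ B₁₁ B₁₂ B₂₁ B₂₂,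
        b = Matrix.reindex e e (Matrix.fromBlocks B₁₁ B₁₂ B₂₁ B₂₂) :=
      ⟨_, _, _, _, by
        rw [Matrix.fromBlocks_toBlocks (b.submatrix e e)]; simp⟩
    simp only [blockDiag, ← he, Matrix.reindex_apply, Matrix.submatrix_mul_equiv,
      Matrix.fromBlocks_multiply, Matrix.transpose_submatrix, Matrix.fromBlocks_transpose] at hK hb
    have hK' : Matrix.fromBlocks _ _ _ _ = Matrix.fromBlocks _ _ _ _ :=
      (Matrix.reindex e e).injective hK
    have hb' : Matrix.fromBlocks _ _ _ _ = (1 : Matrix (Fin m ⊕ Fin l) (Fin m ⊕ Fin l) ℝ) :=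
      (Matrix.reindex e e).injective (hb.trans (Matrix.submatrix_one_equiv e.symm).symm)
    rw [Matrix.fromBlocks_inj] at hK'
    -- Comparing off-diagonal blocks in `b K = K b` shows that each equals its own negative.
    obtain ⟨-, h12, h21, -⟩ := hK'
    have h12' : B₁₂ = 0 := by
      ext i j
      have := congrFun (congrFun h12 i) j
      simp at this ⊢
      linarith
    have h21' : B₂₁ = 0 := by
      ext i j
      have := congrFun (congrFun h21 i) j
      simp at this ⊢
      linarith
    subst h12' h21'
    rw [← Matrix.fromBlocks_one, Matrix.fromBlocks_inj] at hb'
    obtain ⟨h1, -, -, h2⟩ := hb'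
    refine ⟨⟨_, mul_self_mem_specialOrthogonalGroup (b :=
      Matrix.reindex e e (Matrix.fromBlocks B₁₁ 0 0 B₂₂)) ?_⟩,
      ⟨⟨B₁₁ * B₁₁, mul_self_mem_specialOrthogonalGroup (by simpa using h1)⟩,
       ⟨B₂₂ * B₂₂, mul_self_mem_specialOrthogonalGroup (by simpa using h2)⟩, ?_⟩, rfl⟩
    · simpa [Matrix.fromBlocks_transpose, Matrix.submatrix_mul_equiv, Matrix.fromBlocks_multiply]
        using hb
    · simpa [blockDiag, ← he] using blockDiag_mul h B₁₁ B₁₁ B₂₂ B₂₂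

namespace IsSymmetricPair

variable {G : Subgroup (SO n)} {K : Matrix (Fin n) (Fin n) ℝ} {ε : ℝ}

/-- Differentiating `exp (t A) ∈ G` at `t = 0` gives both conditions on the right; being linear,
they pass to the span. -/
theorem mem_lieAlgebra_iff (hK : IsSymmetricPair G K ε) {A : Matrix (Fin n) (Fin n) ℝ} :
    A ∈ lieAlgebra G ↔ Aᵀ = -A ∧ A * K = K * A := by
  constructor
  · intro hA
    let S : Submodule ℝ (Matrix (Fin n) (Fin n) ℝ) :=
      { carrier := {A | Aᵀ = -A ∧ A * K = K * A}
        add_mem' := by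
          rintro A B ⟨h1, h2⟩ ⟨h3, h4⟩
          exact ⟨by rw [Matrix.transpose_add, h1, h3, neg_add], by rw [add_mul, mul_add, h2, h4]⟩
        zero_mem' := by simp
        smul_mem' := by
          rintro c A ⟨h1, h2⟩
          exact ⟨by rw [Matrix.transpose_smul, h1, smul_neg],
            by rw [smul_mul_assoc, mul_smul_comm, h2]⟩ }
    refine (Submodule.span_le (p := S)).2 ?_ hA
    intro A hA
    refine ⟨eq_of_forall_exp_smul_eq fun t => ?_, commute_of_forall_commute_exp_smul fun t => ?_⟩
    · obtain ⟨a, -, ha⟩ := hA t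
      have h1 := transpose_mul_self_coe a
      rw [ha, ← Matrix.exp_transpose, Matrix.transpose_smul] at h1
      have h2 : NormedSpace.exp (t • A) * NormedSpace.exp (t • -A) = 1 := by
        rw [smul_neg, ← Matrix.exp_add_of_commute _ _ (Commute.refl (t • A)).neg_right]
        simp
      exact left_inv_eq_right_inv h1 h2
    · obtain ⟨a, haG, ha⟩ := hA t
      rw [← ha]
      exact hK.commute a haG
  · rintro ⟨h1, h2⟩
    refine Submodule.subset_span fun t => ?_
    -- The factor `t / 2` appears because `exp (t A)` is placed in `G` as the square of `exp ((t /
    -- 2) A)`.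
    have hcomm : (NormedSpace.exp ((t / 2) • A)) * K = K * (NormedSpace.exp ((t / 2) • A)) :=
      exp_commute_of_commute (by rw [smul_mul_assoc, mul_smul_comm, h2])
    have horth : (NormedSpace.exp ((t / 2) • A))ᵀ * (NormedSpace.exp ((t / 2) • A)) = 1 := by
      rw [← Matrix.exp_transpose, Matrix.transpose_smul, h1, smul_neg,
        ← Matrix.exp_add_of_commute _ _ (Commute.refl ((t / 2) • A)).neg_left]
      simp
    obtain ⟨a, ha, hab⟩ := hK.exists_sq _ horth hcomm
    refine ⟨a, ha, ?_⟩
    rw [hab, ← Matrix.exp_add_of_commute _ _ (Commute.refl _), ← add_smul]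
    congr 2
    ring

theorem transpose_conj (hK : IsSymmetricPair G K ε) {A : Matrix (Fin n) (Fin n) ℝ}
    (hA : Aᵀ = -A) : (K * A * K)ᵀ = -(K * A * K) := by
  rw [Matrix.transpose_mul, Matrix.transpose_mul, hA, hK.transpose_eq]
  simp [smul_smul, hK.sq_eq_one, mul_assoc]

/-- The orthogonal projection onto the Lie algebra is the average over the involution. -/
theorem projLie_eq (hK : IsSymmetricPair G K ε) {A : Matrix (Fin n) (Fin n) ℝ} (hA : Aᵀ = -A) :
    projLie G A = (1 / 2 : ℝ) • (A + ε • (K * A * K)) := by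
  set B := (1 / 2 : ℝ) • (A + ε • (K * A * K)) with hB
  have hBmem : B ∈ lieAlgebra G := by
    refine hK.mem_lieAlgebra_iff.2 ⟨?_, ?_⟩
    · rw [hB, Matrix.transpose_smul, Matrix.transpose_add, Matrix.transpose_smul,
        hK.transpose_conj hA, hA]
      module
    · have h1 : K * A * K * K = ε • (K * A) := by rw [mul_assoc, hK.mul_self]; simp
      have h2 : K * (K * A * K) = ε • (A * K) := by
        rw [← mul_assoc, ← mul_assoc, hK.mul_self]; simp
      rw [hB, smul_mul_assoc, mul_smul_comm, add_mul, mul_add, smul_mul_assoc, mul_smul_comm, h1,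
        h2, smul_smul, smul_smul, hK.sq_eq_one, one_smul, one_smul, add_comm]
  -- Both `A - projLie G A` and `A - B` are trace-orthogonal to 𝔤, so their difference `X`, itself
  -- in 𝔤, is orthogonal to itself.
  have hX : projLie G A - B ∈ lieAlgebra G := sub_mem (projLie_mem G A) hBmem
  set X := projLie G A - B
  have h1 := trace_sub_projLie G A hX
  have h2 : ((A - B)ᵀ * X).trace = 0 := by
    have h3 : (A - B)ᵀ = -((1 / 2 : ℝ) • (A - ε • (K * A * K))) := by
      rw [hB, Matrix.transpose_sub, Matrix.transpose_smul, Matrix.transpose_add,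
        Matrix.transpose_smul, hK.transpose_conj hA, hA]
      module
    have h4 : (K * A * K * X).trace = ε * (A * X).trace := by
      rw [mul_assoc K A K, mul_assoc, Matrix.trace_mul_comm, mul_assoc, mul_assoc,
        (hK.mem_lieAlgebra_iff.1 hX).2, ← mul_assoc K K X, hK.mul_self]
      simp
    rw [h3, neg_mul, Matrix.trace_neg, smul_mul_assoc, sub_mul, smul_mul_assoc, Matrix.trace_smul,
      Matrix.trace_sub, Matrix.trace_smul, h4, smul_eq_mul, smul_eq_mul, ← mul_assoc, hK.sq_eq_one]
    ring
  have h3 : (Xᵀ * X).trace = 0 := by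
    have : X = (A - B) - (A - projLie G A) := by simp only [X]; abel
    have h5 : Xᵀ = (A - B)ᵀ - (A - projLie G A)ᵀ := by rw [this, Matrix.transpose_sub]
    rw [h5, sub_mul, Matrix.trace_sub, h1, h2, sub_zero]
  have h4 : X = 0 := by
    rw [← Matrix.conjTranspose_eq_transpose_of_trivial] at h3
    exact Matrix.trace_conjTranspose_mul_self_eq_zero_iff.1 h3
  exact sub_eq_zero.1 h4

theorem projPerp_eq (hK : IsSymmetricPair G K ε) {A : Matrix (Fin n) (Fin n) ℝ} (hA : Aᵀ = -A) :
    projPerp G A = (1 / 2 : ℝ) • (A - ε • (K * A * K)) := by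
  rw [projPerp, LinearMap.sub_apply, LinearMap.id_apply, hK.projLie_eq hA]
  module

theorem transpose_projPerp (hK : IsSymmetricPair G K ε) {A : Matrix (Fin n) (Fin n) ℝ}
    (hA : Aᵀ = -A) : (projPerp G A)ᵀ = -projPerp G A := by
  rw [hK.projPerp_eq hA, Matrix.transpose_smul, Matrix.transpose_sub, Matrix.transpose_smul,
    hK.transpose_conj hA, hA]
  module

/-- With this and the next two lemmas, sorting skew matrices into 𝔤 and 𝔤⊥ amounts to moving `K`
past factors and counting signs. -/
theorem projPerp_mul (hK : IsSymmetricPair G K ε) {A : Matrix (Fin n) (Fin n) ℝ} (hA : Aᵀ = -A) :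
    projPerp G A * K = -(K * projPerp G A) := by
  have h1 : K * A * K * K = ε • (K * A) := by rw [mul_assoc, hK.mul_self]; simp
  have h2 : K * (K * A * K) = ε • (A * K) := by
    rw [← mul_assoc, ← mul_assoc, hK.mul_self]; simp
  rw [hK.projPerp_eq hA, smul_mul_assoc, mul_smul_comm, sub_mul, mul_sub, smul_mul_assoc,
    mul_smul_comm, h1, h2, smul_smul, smul_smul, hK.sq_eq_one]
  module

theorem projPerp_eq_self (hK : IsSymmetricPair G K ε) {A : Matrix (Fin n) (Fin n) ℝ}
    (hA : Aᵀ = -A) (h : A * K = -(K * A)) : projPerp G A = A := by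
  rw [hK.projPerp_eq hA, mul_assoc, h, mul_neg, ← mul_assoc, hK.mul_self]
  simp only [smul_mul_assoc, one_mul, smul_neg, smul_smul, hK.sq_eq_one]
  module

theorem projPerp_eq_zero (hK : IsSymmetricPair G K ε) {A : Matrix (Fin n) (Fin n) ℝ}
    (hA : Aᵀ = -A) (h : A * K = K * A) : projPerp G A = 0 := by
  rw [hK.projPerp_eq hA, mul_assoc, h, ← mul_assoc, hK.mul_self]
  simp only [smul_mul_assoc, one_mul, smul_smul, hK.sq_eq_one]
  module

/-- For a symmetric pair `[𝔤, 𝔤] ⊆ 𝔤`, `[𝔤, 𝔤⊥] ⊆ 𝔤⊥` and `[𝔤⊥, 𝔤⊥] ⊆ 𝔤`. -/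
theorem projPerp_commutator (hK : IsSymmetricPair G K ε) {A B : Matrix (Fin n) (Fin n) ℝ}
    (hA : Aᵀ = -A) (hB : Bᵀ = -B) :
    projPerp G (A * B - B * A) =
      (projLie G A * projPerp G B - projPerp G B * projLie G A) +
        (projPerp G A * projLie G B - projLie G B * projPerp G A) := by
  obtain ⟨s1, c1⟩ := hK.mem_lieAlgebra_iff.1 (projLie_mem G A)
  obtain ⟨s2, c2⟩ := hK.mem_lieAlgebra_iff.1 (projLie_mem G B)
  have s3 := hK.transpose_projPerp hA
  have s4 := hK.transpose_projPerp hB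
  have c3 := hK.projPerp_mul hA
  have c4 := hK.projPerp_mul hB
  have e1 : A = projLie G A + projPerp G A := by simp [projPerp]
  have e2 : B = projLie G B + projPerp G B := by simp [projPerp]
  generalize projLie G A = a at *
  generalize projLie G B = b at *
  generalize projPerp G A = p at *
  generalize projPerp G B = q at *
  -- The brackets `[a, b]` and `[p, q]` commute with `K`, having an even number of anticommuting
  -- factors; the mixed brackets anticommute with it.
  have h1 : projPerp G (a * b - b * a) = 0 := by
    refine hK.projPerp_eq_zero ?_ ?_
    · simp [Matrix.transpose_sub, Matrix.transpose_mul, s1, s2]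
    · rw [sub_mul, mul_sub, mul_assoc, c2, ← mul_assoc, c1, mul_assoc b a K, c1, ← mul_assoc b K a,
        c2, mul_assoc, mul_assoc]
  have h2 : projPerp G (p * q - q * p) = 0 := by
    refine hK.projPerp_eq_zero ?_ ?_
    · simp [Matrix.transpose_sub, Matrix.transpose_mul, s3, s4]
    · rw [sub_mul, mul_sub, mul_assoc, c4, mul_neg, ← mul_assoc, c3, mul_assoc q p K, c3, mul_neg,
        ← mul_assoc q K p, c4, neg_mul, neg_mul, neg_neg, neg_neg, mul_assoc, mul_assoc]
  have h3 : projPerp G ((a * q - q * a) + (p * b - b * p)) = (a * q - q * a) + (p * b - b * p) := by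
    refine hK.projPerp_eq_self ?_ ?_
    · simp [Matrix.transpose_sub, Matrix.transpose_mul, s1, s2, s3, s4]
      abel
    · rw [add_mul, sub_mul, sub_mul, mul_assoc a q K, c4, mul_neg, ← mul_assoc a K q, c1,
        mul_assoc q a K, c1, ← mul_assoc q K a, c4, mul_assoc p b K, c2, ← mul_assoc p K b, c3,
        mul_assoc b p K, c3, mul_neg, ← mul_assoc b K p, c2]
      noncomm_ring
  have h4 : A * B - B * A
      = (a * b - b * a) + (p * q - q * p) + ((a * q - q * a) + (p * b - b * p)) := by
    rw [e1, e2]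
    noncomm_ring
  rw [h4, map_add, map_add, h1, h2, h3]
  simp

end IsSymmetricPair

end SymmetricPairs

/-! ### Contractions, and the algebraic identity behind the curvature formula. -/

section Algebra

variable {n : ℕ}

/-- Traces of bilinear forms do not depend on the orthonormal basis; this moves the sums in the
definitions to frames in `P`. -/
theorem sum_bilinear_orthonormalBasis {V ι κ : Type*} [NormedAddCommGroup V]
    [InnerProductSpace ℝ V] [Fintype ι] [Fintype κ] (e : OrthonormalBasis ι ℝ V)
    (s : OrthonormalBasis κ ℝ V) (f : V → V → ℝ) (h₁ : ∀ w, IsLinearMap ℝ fun v => f v w)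
    (h₂ : ∀ v, IsLinearMap ℝ (f v)) : ∑ i, f (e i) (e i) = ∑ k, f (s k) (s k) := by
  have hexp : ∀ i, f (e i) (e i) =
      ∑ k, ∑ l, (inner ℝ (s k) (e i) * inner ℝ (e i) (s l)) * f (s k) (s l) := by
    intro i
    have a1 : ∀ w, f (e i) w = ∑ k, inner ℝ (s k) (e i) * f (s k) w := by
      intro w
      conv_lhs => rw [← s.sum_repr' (e i)]
      refine (map_sum (IsLinearMap.mk' _ (h₁ w)) (fun k => inner ℝ (s k) (e i) • s k) _).trans ?_
      exact Finset.sum_congr rfl fun k _ => (h₁ w).map_smul _ _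
    have a2 : ∀ v, f v (e i) = ∑ l, inner ℝ (s l) (e i) * f v (s l) := by
      intro v
      conv_lhs => rw [← s.sum_repr' (e i)]
      refine (map_sum (IsLinearMap.mk' _ (h₂ v)) (fun k => inner ℝ (s k) (e i) • s k) _).trans ?_
      exact Finset.sum_congr rfl fun k _ => (h₂ v).map_smul _ _
    rw [a1]
    refine Finset.sum_congr rfl fun k _ => ?_
    rw [a2, Finset.mul_sum]
    refine Finset.sum_congr rfl fun l _ => ?_
    rw [real_inner_comm (e i) (s l)]
    ring
  classical
  simp only [hexp]
  rw [Finset.sum_comm]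
  refine Finset.sum_congr rfl fun k _ => ?_
  rw [Finset.sum_comm]
  simp only [← Finset.sum_mul, e.sum_inner_mul_inner, orthonormal_iff_ite.1 s.orthonormal]
  simp

/-- Here `a i` stands for `ω(s_i)` and `D i j` for the derivative of `ω(s_j)` along `s_i`. The
hypotheses `h0` and `h1` say that the components of `χ` and their derivatives vanish. -/
theorem sum_projPerp_curvature {G : Subgroup (SO n)} {K : Matrix (Fin n) (Fin n) ℝ} {ε : ℝ}
    (hK : IsSymmetricPair G K ε) (a : Fin n → Matrix (Fin n) (Fin n) ℝ)
    (D : Fin n → Fin n → Matrix (Fin n) (Fin n) ℝ) (ha : ∀ i, (a i).transpose = -a i)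
    (hD : ∀ i j, (D i j).transpose = -D i j) (h0 : ∀ k, ∑ b, projPerp G (a b) k b = 0)
    (h1 : ∀ i k, ∑ b, projPerp G (D i b) k b = 0) :
    ∑ i, ∑ j, projPerp G (D i j - D j i - ∑ b, (a i b j - a j b i) • a b
      + (a i * a j - a j * a i)) i j
      = -2 * ∑ i, ∑ j, ∑ k, projPerp G (a i) k j * projPerp G (a k) i j := by
  have skew : ∀ {A : Matrix (Fin n) (Fin n) ℝ}, A.transpose = -A → ∀ i j, A i j = -A j i := by
    intro A hA i j
    exact congrFun (congrFun hA j) i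
  have hα : ∀ i k l, projLie G (a i) k l = -projLie G (a i) l k := fun i =>
    skew (hK.mem_lieAlgebra_iff.1 (projLie_mem G (a i))).1
  have hβ : ∀ i k l, projPerp G (a i) k l = -projPerp G (a i) l k := fun i =>
    skew (hK.transpose_projPerp (ha i))
  have hDβ : ∀ i j k l, projPerp G (D i j) k l = -projPerp G (D i j) l k := fun i j =>
    skew (hK.transpose_projPerp (hD i j))
  have hab : ∀ i k l, a i k l = projLie G (a i) k l + projPerp G (a i) k l := by
    intro i k l
    simp [projPerp]
  have e1 : ∀ i j, projPerp G (D i j - D j i - ∑ b, (a i b j - a j b i) • a b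
      + (a i * a j - a j * a i)) i j
      = projPerp G (D i j) i j + projPerp G (D j i) j i
        - ∑ b, (a i b j - a j b i) * projPerp G (a b) i j
        + (∑ k, projLie G (a i) i k * projPerp G (a j) k j
          - ∑ k, projPerp G (a j) i k * projLie G (a i) k j
          + (∑ k, projPerp G (a i) i k * projLie G (a j) k j
          - ∑ k, projLie G (a j) i k * projPerp G (a i) k j)) := by
    intro i j
    rw [map_add, map_sub, map_sub, hK.projPerp_commutator (ha i) (ha j), map_sum, hDβ j i j i]
    simp only [Matrix.add_apply, Matrix.sub_apply, Matrix.sum_apply, map_smul, Matrix.smul_apply,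
      smul_eq_mul, Matrix.mul_apply]
    ring
  simp only [e1]
  simp only [hab]
  obtain ⟨α, hp⟩ : ∃ α : Fin n → Matrix (Fin n) (Fin n) ℝ, ∀ i, projLie G (a i) = α i :=
    ⟨_, fun _ => rfl⟩
  obtain ⟨β, hq⟩ : ∃ β : Fin n → Matrix (Fin n) (Fin n) ℝ, ∀ i, projPerp G (a i) = β i :=
    ⟨_, fun _ => rfl⟩
  simp only [hp, hq] at hα hβ h0 ⊢
  simp only [Finset.sum_add_distrib, Finset.sum_sub_distrib, sub_mul, add_mul]
  -- The sums `t1` to `t4` contain a trace of `D` or of `β` and vanish. The remaining `αβ` sums are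
  -- all `± ∑ α_i(b,j) β_b(i,j)`: the bracket term `[s_i, s_j]` contributes it with factor `-2`, the
  -- matrix commutator with `+2`.
  have t1 : ∑ i, ∑ j, projPerp G (D i j) i j = 0 := by simp [h1]
  have t2 : ∑ i, ∑ j, projPerp G (D j i) j i = 0 := by rw [Finset.sum_comm]; simp [h1]
  have t3 : ∑ i, ∑ j, ∑ k, α i i k * β j k j = 0 := by
    refine Finset.sum_eq_zero fun i _ => ?_
    rw [Finset.sum_comm]
    simp [← Finset.mul_sum, h0]
  have t4 : ∑ i, ∑ j, ∑ k, β i i k * α j k j = 0 := by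
    rw [Finset.sum_comm]
    refine Finset.sum_eq_zero fun j _ => ?_
    rw [Finset.sum_comm]
    refine Finset.sum_eq_zero fun k _ => ?_
    rw [← Finset.sum_mul, Finset.sum_congr rfl fun i _ => hβ i i k, Finset.sum_neg_distrib, h0]
    simp
  have t5 : ∑ i, ∑ j, ∑ b, α j b i * β b i j = -∑ i, ∑ j, ∑ b, α i b j * β b i j := by
    rw [Finset.sum_comm]
    simp only [← Finset.sum_neg_distrib]
    refine Finset.sum_congr rfl fun i _ => Finset.sum_congr rfl fun j _ =>
      Finset.sum_congr rfl fun b _ => ?_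
    rw [hβ b j i]
    ring
  have t6 : ∑ i, ∑ j, ∑ b, β j b i * β b i j = -∑ i, ∑ j, ∑ b, β i b j * β b i j := by
    rw [Finset.sum_comm]
    simp only [← Finset.sum_neg_distrib]
    refine Finset.sum_congr rfl fun i _ => Finset.sum_congr rfl fun j _ =>
      Finset.sum_congr rfl fun b _ => ?_
    rw [hβ b j i]
    ring
  have t7 : ∑ i, ∑ j, ∑ k, β j i k * α i k j = -∑ i, ∑ j, ∑ b, α i b j * β b i j := by
    simp only [← Finset.sum_neg_distrib]
    refine Finset.sum_congr rfl fun i _ => ?_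
    rw [Finset.sum_comm]
    refine Finset.sum_congr rfl fun j _ => Finset.sum_congr rfl fun b _ => ?_
    rw [hα i b j]
    ring
  have t8 : ∑ i, ∑ j, ∑ k, α j i k * β i k j = ∑ i, ∑ j, ∑ k, β j i k * α i k j := by
    rw [Finset.sum_comm]
    refine Finset.sum_congr rfl fun i _ => Finset.sum_congr rfl fun j _ =>
      Finset.sum_congr rfl fun b _ => ?_
    rw [hβ j b i, hα i j b]
    ring
  rw [t1, t2, t3, t4, t5, t6, t8, t7]
  ring

end Algebra

/-! ### Second derivatives of functions along vector fields. -/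

section Frame

variable {E : Type*} [NormedAddCommGroup E] [NormedSpace ℝ E]
  {H : Type*} [TopologicalSpace H] {I : ModelWithCorners ℝ E H}
  {M : Type*} [TopologicalSpace M] [ChartedSpace H M]
  [RiemannianBundle (fun x : M => TangentSpace I x)]
  [IsManifold I ∞ M] [IsContMDiffRiemannianBundle I ∞ E (fun x : M => TangentSpace I x)]
  [FiniteDimensional ℝ E]

theorem contMDiffAt_inner {k : ℕ∞} {X Y : Π x : M, TangentSpace I x} {x : M}
    (hX : CMDiffAt k (T% X) x) (hY : CMDiffAt k (T% Y) x) :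
    CMDiffAt k (fun y => inner ℝ (X y) (Y y)) x := by
  have : IsContMDiffRiemannianBundle I k E
    (fun x : M => TangentSpace I x) :=
      IsContMDiffRiemannianBundle.of_le (n := ∞) (by exact_mod_cast le_top)
  exact ContMDiffAt.inner_bundle (F := E)
    (E := fun x : M => TangentSpace I x) (b := id) hX hY

theorem contMDiffAt_mlieBracket {X Y : Π x : M, TangentSpace I x} {x : M}
    (hX : CMDiffAt 2 (T% X) x) (hY : CMDiffAt 2 (T% Y) x) :
    CMDiffAt 1 (T% (VectorField.mlieBracket I X Y)) x := by
  have := FiniteDimensional.complete ℝ E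
  have : IsManifold I ((2 : ℕ∞) + 1) M := IsManifold.of_le (n := ∞) (by norm_cast)
  have : IsManifold I (minSmoothness ℝ 2) M :=
    IsManifold.of_le (n := ∞) (by simp [minSmoothness_of_isRCLikeNormedField]; norm_cast)
  exact ContMDiffAt.mlieBracket_vectorField (m := 1) (n := 2) hX hY (by
    simp [minSmoothness_of_isRCLikeNormedField]; norm_num)

theorem leviCivita_metric_apply {Y Z : Π x : M, TangentSpace I x} {x : M}
    (hY : MDiffAt (T% Y) x) (hZ : MDiffAt (T% Z) x) (v : TangentSpace I x) :
    d% (fun y => inner ℝ (Y y) (Z y)) x v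
      = inner ℝ (leviCivita Y x v) (Z x) + inner ℝ (Y x) (leviCivita Z x v) := by
  have := leviCivita_metric (FiberBundle.mdifferentiableAt_extend I E v)
    hY hZ
  simpa using this

theorem leviCivita_sub_swap {X Y : Π x : M, TangentSpace I x} {x : M}
    (hX : MDiffAt (T% X) x) (hY : MDiffAt (T% Y) x) :
    leviCivita Y x (X x) - leviCivita X x (Y x) = VectorField.mlieBracket I X Y x :=
  (CovariantDerivative.torsion_eq_zero_iff _).1 leviCivita_torsion hX hY

/-- For a unit field `V`, `[Y, f V] = (Y f) V + f [Y, V]` gives `Y f = g([Y, f V], V) - f g([Y, V],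
V)`, so regularity of `Y f` reduces to regularity of Lie brackets. -/
theorem mdifferentiableAt_mvfderiv_apply {f : M → ℝ} {Y V : Π x : M, TangentSpace I x} {x : M}
    (hf : CMDiffAt 2 f x) (hY : CMDiffAt 2 (T% Y) x) (hV : CMDiffAt 2 (T% V) x)
    (hV1 : ∀ y, inner ℝ (V y) (V y) = (1 : ℝ)) :
    MDiffAt (fun y => d% f y (Y y)) x := by
  have h1 : CMDiffAt 1 (fun y => inner ℝ (VectorField.mlieBracket I Y (f • V) y) (V y)
      - f y * inner ℝ (VectorField.mlieBracket I Y V y) (V y)) x := by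
    have hfV : CMDiffAt 2 (T% (f • V)) x := hf.smul_section hV
    exact (contMDiffAt_inner (k := 1) (contMDiffAt_mlieBracket hY hfV) (hV.of_le (by norm_num))).sub
      ((hf.of_le (by norm_num)).mul
        (contMDiffAt_inner (k := 1) (contMDiffAt_mlieBracket hY hV) (hV.of_le (by norm_num))))
  refine (h1.mdifferentiableAt (by norm_num)).congr_of_eventuallyEq ?_
  filter_upwards [(contMDiffAt_iff_contMDiffAt_nhds (by simp)).1 hf,
        (contMDiffAt_iff_contMDiffAt_nhds (by simp)).1 hV] with y hfy hVy
  rw [VectorField.mlieBracket_smul_right (hfy.mdifferentiableAt (by simp))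
    (hVy.mdifferentiableAt (by simp)), inner_add_left, inner_smul_left, inner_smul_left, hV1]
  simp

/-- For vector fields, `[X, Y] f = X (Y f) - Y (X f)`. -/
theorem mvfderiv_mlieBracket {f : M → ℝ} {X Y V : Π x : M, TangentSpace I x} {x : M}
    (hf : CMDiffAt 2 f x) (hX : CMDiffAt 2 (T% X) x) (hY : CMDiffAt 2 (T% Y) x)
    (hV : CMDiffAt 2 (T% V) x) (hV1 : ∀ y, inner ℝ (V y) (V y) = (1 : ℝ)) :
    d% f x (VectorField.mlieBracket I X Y x)
      = d% (fun y => d% f y (Y y)) x (X x) - d% (fun y => d% f y (X y)) x (Y x) := by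
  have := FiniteDimensional.complete ℝ E
  have : IsManifold I (minSmoothness ℝ 3) M :=
    IsManifold.of_le (n := ∞) (by simp [minSmoothness_of_isRCLikeNormedField]; norm_cast)
  have hms : minSmoothness ℝ 2 = 2 := minSmoothness_of_isRCLikeNormedField
  have hfV : CMDiffAt 2 (T% (f • V)) x := hf.smul_section hV
  -- The Jacobi identities for `(X, Y, f V)` and `(X, Y, V)` are compared: the terms in `[X, V]` and
  -- `[Y, V]` are symmetric in `X, Y` and drop out, leaving a multiple of the unit vector `V x`.
  have key : ∀ {X Y : Π x : M, TangentSpace I x}, CMDiffAt 2 (T% X) x → CMDiffAt 2 (T% Y) x →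
      VectorField.mlieBracket I X (VectorField.mlieBracket I Y (f • V)) x =
        d% (fun y => d% f y (Y y)) x (X x) • V x
          + d% f x (Y x) • VectorField.mlieBracket I X V x
          + (d% f x (X x) • VectorField.mlieBracket I Y V x
          + f x • VectorField.mlieBracket I X (VectorField.mlieBracket I Y V) x) := by
    intro X Y hX hY
    have e : VectorField.mlieBracket I Y (f • V) =ᶠ[nhds x]
        (fun y => d% f y (Y y)) • V + f • VectorField.mlieBracket I Y V := by
      filter_upwards [(contMDiffAt_iff_contMDiffAt_nhds (by simp)).1 hf,
        (contMDiffAt_iff_contMDiffAt_nhds (by simp)).1 hV] with y hfy hVy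
      rw [VectorField.mlieBracket_smul_right (hfy.mdifferentiableAt (by simp))
        (hVy.mdifferentiableAt (by simp))]
      rfl
    have hYf := mdifferentiableAt_mvfderiv_apply hf hY hV hV1
    have hVd : MDiffAt (T% V) x := hV.mdifferentiableAt (by simp)
    have hfd : MDiffAt f x := hf.mdifferentiableAt (by simp)
    have hYV : MDiffAt (T% (VectorField.mlieBracket I Y V)) x :=
      (contMDiffAt_mlieBracket hY hV).mdifferentiableAt (by simp)
    refine (Filter.EventuallyEq.mlieBracket_vectorField_eq Filter.EventuallyEq.rfl e).trans ?_
    rw [VectorField.mlieBracket_add_right (hYf.smul_section hVd) (hfd.smul_section hYV),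
      VectorField.mlieBracket_smul_right hYf hVd, VectorField.mlieBracket_smul_right hfd hYV]
  have hJ := VectorField.leibniz_identity_mlieBracket_apply (𝕜 := ℝ) (I := I)
    (U := X) (V := Y) (W := f • V) (x := x) (by rwa [hms]) (by rwa [hms]) (by rwa [hms])
  have hJ' := VectorField.leibniz_identity_mlieBracket_apply (𝕜 := ℝ) (I := I)
    (U := X) (V := Y) (W := V) (x := x) (by rwa [hms]) (by rwa [hms]) (by rwa [hms])
  rw [key hX hY, key hY hX, VectorField.mlieBracket_smul_right (hf.mdifferentiableAt (by simp))
    (hV.mdifferentiableAt (by simp)), hJ'] at hJ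
  have h3 : (d% f x (VectorField.mlieBracket I X Y x)
      - (d% (fun y => d% f y (Y y)) x (X x) - d% (fun y => d% f y (X y)) x (Y x))) • V x = 0 := by
    rw [sub_smul, sub_smul]
    rw [← sub_eq_zero] at hJ
    rw [← neg_eq_zero, ← hJ]
    module
  have h4 := congrArg (fun w => inner ℝ w (V x)) h3
  simp only [inner_smul_left, hV1, inner_zero_left] at h4
  simpa [sub_eq_zero] using h4

end Frame

/-! ### The connection form of an orthonormal frame and the structure equation. -/

section Frame

variable {E : Type*} [NormedAddCommGroup E] [NormedSpace ℝ E]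
  {H : Type*} [TopologicalSpace H] {I : ModelWithCorners ℝ E H}
  {M : Type*} [TopologicalSpace M] [ChartedSpace H M]
  [RiemannianBundle (fun x : M => TangentSpace I x)]
  [IsManifold I ∞ M] [IsContMDiffRiemannianBundle I ∞ E (fun x : M => TangentSpace I x)]
  [FiniteDimensional ℝ E] {n : ℕ}

/-- The Levi-Civita connection form in an orthonormal frame, for an arbitrary model space. -/
def frameForm (s : ∀ y : M, OrthonormalBasis (Fin n) ℝ (TangentSpace I y)) (x : M)
    (v : TangentSpace I x) : Matrix (Fin n) (Fin n) ℝ :=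
  Matrix.of fun i j => inner ℝ (s x i) (leviCivita (fun y => s y j) x v)

/-- The derivative along `v` of the matrix `y ↦ ω(s_b)` of the connection form. -/
def frameFormDeriv (s : ∀ y : M, OrthonormalBasis (Fin n) ℝ (TangentSpace I y)) (x : M)
    (v : TangentSpace I x) (b : Fin n) : Matrix (Fin n) (Fin n) ℝ :=
  Matrix.of fun i j => d% (fun y => frameForm s y (s y b) i j) x v

variable {s : ∀ y : M, OrthonormalBasis (Fin n) ℝ (TangentSpace I y)} {x : M}

theorem mdifferentiableAt_fun_sum {ι : Type*} (t : Finset ι) {f : ι → M → ℝ}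
    (hf : ∀ i ∈ t, MDiffAt (f i) x) : MDiffAt (fun y => ∑ i ∈ t, f i y) x := by
  classical
  induction t using Finset.induction_on with
  | empty => simpa using mdifferentiableAt_const
  | insert a t ha ih =>
    simp only [Finset.sum_insert ha]
    exact (hf a (Finset.mem_insert_self a t)).add
      (ih fun i hi => hf i (Finset.mem_insert_of_mem hi))

theorem mvfderiv_fun_sum {ι : Type*} (t : Finset ι) {f : ι → M → ℝ}
    (hf : ∀ i ∈ t, MDiffAt (f i) x) :
    d% (fun y => ∑ i ∈ t, f i y) x = ∑ i ∈ t, d% (f i) x := by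
  classical
  induction t using Finset.induction_on with
  | empty => simp [mvfderiv_const]
  | insert a t ha ih =>
    have ht : ∀ i ∈ t, MDiffAt (f i) x := fun i hi => hf i (Finset.mem_insert_of_mem hi)
    simp only [Finset.sum_insert ha]
    rw [mvfderiv_fun_add (hf a (Finset.mem_insert_self a t)) (mdifferentiableAt_fun_sum t ht), ih ht]

theorem mvfderiv_fun_sum_mul {ι : Type*} (t : Finset ι) {f g : ι → M → ℝ}
    (hf : ∀ i, MDiffAt (f i) x) (hg : ∀ i, MDiffAt (g i) x) (v : TangentSpace I x) :
    d% (fun y => ∑ i ∈ t, f i y * g i y) x v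
      = ∑ i ∈ t, (f i x * d% (g i) x v + g i x * d% (f i) x v) := by
  rw [mvfderiv_fun_sum t (f := fun i y => f i y * g i y) fun i _ => (hf i).mul (hg i),
    _root_.sum_apply]
  refine Finset.sum_congr rfl fun i _ => ?_
  rw [mvfderiv_fun_mul (hf i) (hg i)]
  simp

theorem mvfderiv_congr {f g : M → ℝ} (h : f =ᶠ[nhds x] g) : d% f x = d% g x := by
  have h1 := h.mfderiv_eq (I := I) (I' := 𝓘(ℝ, ℝ))
  ext v
  exact congrArg (fun L : TangentSpace I x →L[ℝ] ℝ => L v) h1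

theorem frameForm_apply_eq_sum (v : TangentSpace I x) (k l : Fin n) :
    frameForm s x v k l = ∑ b, inner ℝ (s x b) v * frameForm s x (s x b) k l := by
  conv_lhs => rw [← (s x).sum_repr' v]
  simp [frameForm, inner_sum, inner_smul_right]

theorem frameForm_transpose (hs : ∀ i, MDiffAt (T% (fun y => s y i)) x) (v : TangentSpace I x) :
    (frameForm s x v).transpose = -frameForm s x v := by
  ext i j
  have h := leviCivita_metric_apply (hs i) (hs j) v
  have hc : (fun y => inner ℝ (s y i) (s y j)) = fun _ : M => (if i = j then 1 else 0 : ℝ) :=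
    funext fun y => orthonormal_iff_ite.1 (s y).orthonormal i j
  rw [hc, mvfderiv_const, real_inner_comm] at h
  simp only [frameForm, Matrix.transpose_apply, Matrix.neg_apply, Matrix.of_apply]
  simp at h
  linarith

theorem frameForm_swap (hs : ∀ i, MDiffAt (T% (fun y => s y i)) x) (v : TangentSpace I x)
    (k l : Fin n) : frameForm s x v k l = -frameForm s x v l k :=
  congrFun (congrFun (frameForm_transpose hs v) l) k

theorem inner_frame_leviCivita (hs : ∀ i, MDiffAt (T% (fun y => s y i)) x)
    {W : Π x : M, TangentSpace I x} (hW : MDiffAt (T% W) x) (v : TangentSpace I x) (k : Fin n) :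
    inner ℝ (s x k) (leviCivita W x v) = d% (fun y => inner ℝ (s y k) (W y)) x v
      + ∑ m, frameForm s x v k m * inner ℝ (s x m) (W x) := by
  have h1 : inner ℝ (leviCivita (fun y => s y k) x v) (W x)
      = -∑ m, frameForm s x v k m * inner ℝ (s x m) (W x) := by
    rw [← (s x).sum_inner_mul_inner, ← Finset.sum_neg_distrib]
    refine Finset.sum_congr rfl fun m _ => ?_
    rw [frameForm_swap hs, frameForm, Matrix.of_apply, real_inner_comm]
    ring
  rw [leviCivita_metric_apply (hs k) hW v, h1]
  ring

theorem mdifferentiableAt_of_inner_frame (hs : ∀ i, MDiffAt (T% (fun y => s y i)) x)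
    {W : Π x : M, TangentSpace I x} (hW : ∀ k, MDiffAt (fun y => inner ℝ (s y k) (W y)) x) :
    MDiffAt (T% W) x := by
  have : W = fun y => ∑ k, (inner ℝ (s y k) (W y)) • s y k :=
    funext fun y => ((s y).sum_repr' (W y)).symm
  rw [this]
  exact MDifferentiableAt.sum_section fun k _ => (hW k).smul_section (hs k)

/-- Inner products of frame fields are constant, so the Koszul formula reduces to its three bracket
terms. -/
theorem mdifferentiableAt_frameForm (hs : ∀ i, CMDiffAt 2 (T% (fun y => s y i)) x)
    (b k l : Fin n) : MDiffAt (fun y => frameForm s y (s y b) k l) x := by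
  have hbr : ∀ i j m, CMDiffAt 1 (fun y => inner ℝ
      (VectorField.mlieBracket I (fun y => s y i) (fun y => s y j) y) (s y m)) x := fun i j m =>
    contMDiffAt_inner (k := 1) (contMDiffAt_mlieBracket (hs i) (hs j))
      ((hs m).of_le (by norm_num))
  have h1 : MDiffAt (fun y =>
      (1 / 2 : ℝ) * (inner ℝ (VectorField.mlieBracket I (fun y => s y b) (fun y => s y l) y) (s y k)
      - inner ℝ (VectorField.mlieBracket I (fun y => s y l) (fun y => s y k) y) (s y b)
      + inner ℝ (VectorField.mlieBracket I (fun y => s y k) (fun y => s y b) y) (s y l))) x :=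
    ((contMDiffAt_const (c := (1 / 2 : ℝ))).mul (((hbr b l k).sub (hbr l k b)).add
      (hbr k b l))).mdifferentiableAt (by simp)
  refine h1.congr_of_eventuallyEq ?_
  have hev : ∀ᶠ y in nhds x, ∀ i, CMDiffAt 2 (T% (fun y => s y i)) y :=
    Filter.eventually_all.2 fun i => (contMDiffAt_iff_contMDiffAt_nhds (by simp)).1 (hs i)
  filter_upwards [hev] with y hy
  have hd : ∀ i, MDiffAt (T% (fun y => s y i)) y := fun i => (hy i).mdifferentiableAt (by simp)
  have hc : ∀ i j, (fun y => inner ℝ (s y i) (s y j)) = fun _ : M => (if i = j then 1 else 0 : ℝ) :=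
    fun i j => funext fun y => orthonormal_iff_ite.1 (s y).orthonormal i j
  rw [frameForm, Matrix.of_apply, real_inner_comm]
  refine (inner_leviCivita (hd b) (hd l) (hd k)).trans ?_
  simp only [koszul, hc, mvfderiv_const]
  simp

theorem mdifferentiableAt_frameForm_apply (hs : ∀ i, CMDiffAt 2 (T% (fun y => s y i)) x)
    {Y : Π x : M, TangentSpace I x} (hY : MDiffAt (T% Y) x) (k l : Fin n) :
    MDiffAt (fun y => frameForm s y (Y y) k l) x := by
  have hd : ∀ i, MDiffAt (T% (fun y => s y i)) x := fun i => (hs i).mdifferentiableAt (by simp)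
  rw [show (fun y => frameForm s y (Y y) k l)
    = fun y => ∑ b, inner ℝ (s y b) (Y y) * frameForm s y (s y b) k l from
      funext fun y => frameForm_apply_eq_sum (Y y) k l]
  exact mdifferentiableAt_fun_sum _ fun b _ =>
    (mdifferentiableAt_inner (hd b) hY).mul (mdifferentiableAt_frameForm hs b k l)

theorem mvfderiv_frameForm_apply (hs : ∀ i, CMDiffAt 2 (T% (fun y => s y i)) x)
    {Y : Π x : M, TangentSpace I x} (hY : MDiffAt (T% Y) x) (v : TangentSpace I x) (k l : Fin n) :
    d% (fun y => frameForm s y (Y y) k l) x v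
      = ∑ b, (inner ℝ (s x b) (Y x) * frameFormDeriv s x v b k l
        + frameForm s x (s x b) k l * d% (fun y => inner ℝ (s y b) (Y y)) x v) := by
  have hd : ∀ i, MDiffAt (T% (fun y => s y i)) x := fun i => (hs i).mdifferentiableAt (by simp)
  rw [show (fun y => frameForm s y (Y y) k l)
    = fun y => ∑ b, inner ℝ (s y b) (Y y) * frameForm s y (s y b) k l from
      funext fun y => frameForm_apply_eq_sum (Y y) k l]
  exact mvfderiv_fun_sum_mul _ (fun b => mdifferentiableAt_inner (hd b) hY)
    (fun b => mdifferentiableAt_frameForm hs b k l) v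

/-- The curvature in terms of the connection form of an orthonormal frame, `Ω = dω + ω ∧ ω`. -/
theorem inner_frame_curvatureField (hs : ∀ i, CMDiffAt 2 (T% (fun y => s y i)) x)
    {X Y Z : Π x : M, TangentSpace I x} (hX : CMDiffAt 2 (T% X) x) (hY : CMDiffAt 2 (T% Y) x)
    (hZ : CMDiffAt 2 (T% Z) x) (k : Fin n) :
    inner ℝ (s x k) (curvatureField leviCivita X Y Z x)
      = ∑ l, (d% (fun y => frameForm s y (Y y) k l) x (X x)
          - d% (fun y => frameForm s y (X y) k l) x (Y x)
          - frameForm s x (VectorField.mlieBracket I X Y x) k l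
          + ∑ m, (frameForm s x (X x) k m * frameForm s x (Y x) m l
            - frameForm s x (Y x) k m * frameForm s x (X x) m l)) * inner ℝ (s x l) (Z x) := by
  have hd : ∀ i, MDiffAt (T% (fun y => s y i)) x := fun i => (hs i).mdifferentiableAt (by simp)
  have hev : ∀ᶠ y in nhds x, ∀ i, CMDiffAt 2 (T% (fun y => s y i)) y :=
    Filter.eventually_all.2 fun i => (contMDiffAt_iff_contMDiffAt_nhds (by simp)).1 (hs i)
  have hf : ∀ l, CMDiffAt 2 (fun y => inner ℝ (s y l) (Z y)) x := fun l =>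
    contMDiffAt_inner (k := 2) (hs l) hZ
  have hfd : ∀ l, MDiffAt (fun y => inner ℝ (s y l) (Z y)) x := fun l =>
    (hf l).mdifferentiableAt (by simp)
  -- The frame field `s k` serves as the auxiliary unit field for the second-derivative lemmas.
  have hunit : ∀ y, inner ℝ (s y k) (s y k) = (1 : ℝ) := fun y => by simp
  have hco : ∀ (T : Π x : M, TangentSpace I x) (j : Fin n),
      (fun y => inner ℝ (s y j) (leviCivita Z y (T y))) =ᶠ[nhds x]
        fun y => d% (fun y => inner ℝ (s y j) (Z y)) y (T y)
          + ∑ m, frameForm s y (T y) j m * inner ℝ (s y m) (Z y) := by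
    intro T j
    filter_upwards [hev, (contMDiffAt_iff_contMDiffAt_nhds (by simp)).1 hZ] with y hy hZy
    exact inner_frame_leviCivita (fun i => (hy i).mdifferentiableAt (by simp))
      (hZy.mdifferentiableAt (by simp)) _ _
  have hm : ∀ {T : Π x : M, TangentSpace I x}, CMDiffAt 2 (T% T) x → ∀ j,
      MDiffAt (fun y => ∑ m, frameForm s y (T y) j m * inner ℝ (s y m) (Z y)) x := fun hT j =>
    mdifferentiableAt_fun_sum _ fun m _ =>
      (mdifferentiableAt_frameForm_apply hs (hT.mdifferentiableAt (by simp)) j m).mul (hfd m)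
  have hdf : ∀ {T : Π x : M, TangentSpace I x}, CMDiffAt 2 (T% T) x → ∀ j,
      MDiffAt (fun y => d% (fun y => inner ℝ (s y j) (Z y)) y (T y)) x := fun hT j =>
    mdifferentiableAt_mvfderiv_apply (hf j) hT (hs k) hunit
  -- Needed because `leviCivita` takes the value `0` at fields that are not differentiable.
  have hW : ∀ {T : Π x : M, TangentSpace I x}, CMDiffAt 2 (T% T) x →
      MDiffAt (T% (fun y => leviCivita Z y (T y))) x := fun hT =>
    mdifferentiableAt_of_inner_frame hd fun j =>
      ((hdf hT j).add (hm hT j)).congr_of_eventuallyEq (hco _ j)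
  have hsecond : ∀ {T : Π x : M, TangentSpace I x}, CMDiffAt 2 (T% T) x → ∀ v : TangentSpace I x,
      inner ℝ (s x k) (leviCivita (fun y => leviCivita Z y (T y)) x v)
        = d% (fun y => d% (fun y => inner ℝ (s y k) (Z y)) y (T y)) x v
          + ∑ l, (frameForm s x (T x) k l * d% (fun y => inner ℝ (s y l) (Z y)) x v
            + inner ℝ (s x l) (Z x) * d% (fun y => frameForm s y (T y) k l) x v)
          + ∑ l, frameForm s x v k l * d% (fun y => inner ℝ (s y l) (Z y)) x (T x)
          + ∑ l, ∑ m, frameForm s x v k m * frameForm s x (T x) m l * inner ℝ (s x l) (Z x) := by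
    intro T hT v
    have hTd : MDiffAt (T% T) x := hT.mdifferentiableAt (by simp)
    rw [inner_frame_leviCivita hd (hW hT), mvfderiv_congr (hco T k),
      mvfderiv_fun_add (hdf hT k) (hm hT k), _root_.add_apply, add_assoc, add_assoc, add_assoc,
      add_right_inj]
    congr 1
    · exact mvfderiv_fun_sum_mul _ (fun m => mdifferentiableAt_frameForm_apply hs hTd k m) hfd v
    · rw [Finset.sum_comm, ← Finset.sum_add_distrib]
      refine Finset.sum_congr rfl fun m _ => ?_
      rw [(hco T m).eq_of_nhds, mul_add, Finset.mul_sum]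
      simp only [mul_assoc]
  -- Second derivatives of the components of `Z` cancel against `[X, Y]`; the terms with one
  -- derivative of such a component are symmetric in `X, Y` and cancel too.
  rw [curvatureField, inner_sub_right, inner_sub_right, hsecond hY, hsecond hX,
    inner_frame_leviCivita hd (hZ.mdifferentiableAt (by simp)),
    mvfderiv_mlieBracket (hf k) hX hY (hs k) hunit]
  have hsum : ∀ l, (d% (fun y => frameForm s y (Y y) k l) x (X x)
          - d% (fun y => frameForm s y (X y) k l) x (Y x)
          - frameForm s x (VectorField.mlieBracket I X Y x) k l
          + ∑ m, (frameForm s x (X x) k m * frameForm s x (Y x) m l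
            - frameForm s x (Y x) k m * frameForm s x (X x) m l)) * inner ℝ (s x l) (Z x)
      = inner ℝ (s x l) (Z x) * d% (fun y => frameForm s y (Y y) k l) x (X x)
        - inner ℝ (s x l) (Z x) * d% (fun y => frameForm s y (X y) k l) x (Y x)
        - frameForm s x (VectorField.mlieBracket I X Y x) k l * inner ℝ (s x l) (Z x)
        + (∑ m, frameForm s x (X x) k m * frameForm s x (Y x) m l * inner ℝ (s x l) (Z x)
          - ∑ m, frameForm s x (Y x) k m * frameForm s x (X x) m l * inner ℝ (s x l) (Z x)) := by
    intro l
    rw [← Finset.sum_sub_distrib, add_mul, Finset.sum_mul]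
    simp only [sub_mul]
    ring
  rw [Finset.sum_congr rfl fun l _ => hsum l]
  simp only [Finset.sum_add_distrib, Finset.sum_sub_distrib]
  ring

theorem inner_frame_curvature (hs : ∀ i, CMDiffAt 2 (T% (fun y => s y i)) x)
    (v w : TangentSpace I x) (k l : Fin n) :
    inner ℝ (s x k) (curvature leviCivita x v w (s x l))
      = (∑ b, (inner ℝ (s x b) w * frameFormDeriv s x v b k l
          - inner ℝ (s x b) v * frameFormDeriv s x w b k l))
        - (∑ b, (∑ m, (frameForm s x v b m * inner ℝ (s x m) w
          - frameForm s x w b m * inner ℝ (s x m) v)) * frameForm s x (s x b) k l)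
        + ∑ m, (frameForm s x v k m * frameForm s x w m l
            - frameForm s x w k m * frameForm s x v m l) := by
  have hd : ∀ i, MDiffAt (T% (fun y => s y i)) x := fun i => (hs i).mdifferentiableAt (by simp)
  set X := FiberBundle.extend E v with hXdef
  set Y := FiberBundle.extend E w with hYdef
  have hX : CMDiffAt 2 (T% X) x := FiberBundle.contMDiffAt_extend I E v
  have hY : CMDiffAt 2 (T% Y) x := FiberBundle.contMDiffAt_extend I E w
  have hXd : MDiffAt (T% X) x := hX.mdifferentiableAt (by simp)
  have hYd : MDiffAt (T% Y) x := hY.mdifferentiableAt (by simp)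
  have hXx : X x = v := FiberBundle.extend_apply_self E v
  have hYx : Y x = w := FiberBundle.extend_apply_self E w
  rw [curvature, inner_frame_curvatureField hs hX hY (FiberBundle.contMDiffAt_extend I E _)]
  -- By torsion-freeness the bracket contains the derivatives of the components of `X` and `Y`. They
  -- cancel those from the product rule, so only the values `v`, `w` survive, whatever the
  -- extensions.
  have hbr : ∀ b, inner ℝ (s x b) (VectorField.mlieBracket I X Y x)
      = d% (fun y => inner ℝ (s y b) (Y y)) x v - d% (fun y => inner ℝ (s y b) (X y)) x w
        + ∑ m, (frameForm s x v b m * inner ℝ (s x m) w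
          - frameForm s x w b m * inner ℝ (s x m) v) := by
    intro b
    rw [← leviCivita_sub_swap hXd hYd, inner_sub_right, inner_frame_leviCivita hd hYd,
      inner_frame_leviCivita hd hXd, hXx, hYx, Finset.sum_sub_distrib]
    ring
  rw [Finset.sum_eq_single l]
  · rw [FiberBundle.extend_apply_self, orthonormal_iff_ite.1 (s x).orthonormal, if_pos rfl, mul_one,
      mvfderiv_frameForm_apply hs hYd, mvfderiv_frameForm_apply hs hXd,
      frameForm_apply_eq_sum (VectorField.mlieBracket I X Y x), hXx, hYx]
    simp only [hbr]
    rw [add_left_inj, ← Finset.sum_sub_distrib, ← Finset.sum_sub_distrib, ← Finset.sum_sub_distrib]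
    refine Finset.sum_congr rfl fun b _ => ?_
    ring
  · intro j _ hj
    rw [FiberBundle.extend_apply_self, orthonormal_iff_ite.1 (s x).orthonormal, if_neg hj, mul_zero]
  · simp

end Frame

/-! ### Change of frame, and bilinearity of the curvature matrix. -/

section Frame

variable {E : Type*} [NormedAddCommGroup E] [NormedSpace ℝ E]
  {H : Type*} [TopologicalSpace H] {I : ModelWithCorners ℝ E H}
  {M : Type*} [TopologicalSpace M] [ChartedSpace H M]
  [RiemannianBundle (fun x : M => TangentSpace I x)]
  [IsManifold I ∞ M] [IsContMDiffRiemannianBundle I ∞ E (fun x : M => TangentSpace I x)]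
  [FiniteDimensional ℝ E] {n : ℕ}
  {s t : ∀ y : M, OrthonormalBasis (Fin n) ℝ (TangentSpace I y)} {x : M}

theorem frameForm_add (v w : TangentSpace I x) :
    frameForm s x (v + w) = frameForm s x v + frameForm s x w := by
  ext i j; simp [frameForm, inner_add_right]

theorem frameForm_smul (c : ℝ) (v : TangentSpace I x) :
    frameForm s x (c • v) = c • frameForm s x v := by
  ext i j; simp [frameForm, inner_smul_right]

theorem frameFormDeriv_add (v w : TangentSpace I x) (b : Fin n) :
    frameFormDeriv s x (v + w) b = frameFormDeriv s x v b + frameFormDeriv s x w b := by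
  ext i j; simp [frameFormDeriv]

theorem frameFormDeriv_smul (c : ℝ) (v : TangentSpace I x) (b : Fin n) :
    frameFormDeriv s x (c • v) b = c • frameFormDeriv s x v b := by
  ext i j; simp [frameFormDeriv]

theorem frameFormDeriv_transpose (hs : ∀ i, CMDiffAt 2 (T% (fun y => s y i)) x)
    (v : TangentSpace I x) (b : Fin n) :
    (frameFormDeriv s x v b).transpose = -frameFormDeriv s x v b := by
  have hev : ∀ᶠ y in nhds x, ∀ i, CMDiffAt 2 (T% (fun y => s y i)) y :=
    Filter.eventually_all.2 fun i => (contMDiffAt_iff_contMDiffAt_nhds (by simp)).1 (hs i)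
  ext i j
  have h : (fun y => frameForm s y (s y b) j i) =ᶠ[nhds x] fun y => -frameForm s y (s y b) i j := by
    filter_upwards [hev] with y hy
    exact frameForm_swap (fun i => (hy i).mdifferentiableAt (by simp)) _ _ _
  simp only [frameFormDeriv, Matrix.transpose_apply, Matrix.of_apply, Matrix.neg_apply]
  rw [mvfderiv_congr h, mvfderiv_fun_neg]
  simp

theorem linearMap_matrix_apply (L : Matrix (Fin n) (Fin n) ℝ →ₗ[ℝ] Matrix (Fin n) (Fin n) ℝ)
    (A : Matrix (Fin n) (Fin n) ℝ) (k l : Fin n) :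
    L A k l = ∑ p : Fin n × Fin n, A p.1 p.2 * L (Matrix.single p.1 p.2 1) k l := by
  conv_lhs => rw [Matrix.matrix_eq_sum_single A]
  rw [Fintype.sum_prod_type, map_sum, Matrix.sum_apply]
  refine Finset.sum_congr rfl fun i _ => ?_
  rw [map_sum, Matrix.sum_apply]
  refine Finset.sum_congr rfl fun j _ => ?_
  rw [← mul_one (A i j), ← smul_eq_mul, ← Matrix.smul_single, map_smul, Matrix.smul_apply,
    smul_eq_mul, smul_eq_mul, mul_one]

theorem mdifferentiableAt_linearMap_matrix
    (L : Matrix (Fin n) (Fin n) ℝ →ₗ[ℝ] Matrix (Fin n) (Fin n) ℝ)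
    {A : M → Matrix (Fin n) (Fin n) ℝ} (hA : ∀ i j, MDiffAt (fun y => A y i j) x) (k l : Fin n) :
    MDiffAt (fun y => L (A y) k l) x := by
  have h : (fun y => L (A y) k l) = fun y => ∑ p : Fin n × Fin n,
      A y p.1 p.2 * L (Matrix.single p.1 p.2 1) k l :=
    funext fun y => linearMap_matrix_apply L (A y) k l
  rw [h]
  refine mdifferentiableAt_fun_sum _ fun p _ => (hA p.1 p.2).mul ?_
  exact mdifferentiableAt_const (c := L (Matrix.single p.1 p.2 1) k l)

/-- Used for `projPerp G`, to differentiate `χ = 0`, and for the commutator with `K`. -/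
theorem mvfderiv_linearMap_matrix
    (L : Matrix (Fin n) (Fin n) ℝ →ₗ[ℝ] Matrix (Fin n) (Fin n) ℝ)
    {A : M → Matrix (Fin n) (Fin n) ℝ} (hA : ∀ i j, MDiffAt (fun y => A y i j) x) (k l : Fin n)
    (v : TangentSpace I x) :
    d% (fun y => L (A y) k l) x v = L (Matrix.of fun i j => d% (fun y => A y i j) x v) k l := by
  have h : (fun y => L (A y) k l) = fun y => ∑ p : Fin n × Fin n,
      A y p.1 p.2 * L (Matrix.single p.1 p.2 1) k l :=
    funext fun y => linearMap_matrix_apply L (A y) k l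
  rw [h, mvfderiv_fun_sum_mul (f := fun (p : Fin n × Fin n) y => A y p.1 p.2)
    (g := fun (p : Fin n × Fin n) _ => L (Matrix.single p.1 p.2 1) k l) Finset.univ (fun p => hA p.1 p.2)
    (fun p => mdifferentiableAt_const (c := L (Matrix.single p.1 p.2 1) k l)) v,
    linearMap_matrix_apply L (Matrix.of _)]
  refine Finset.sum_congr rfl fun p _ => ?_
  rw [mvfderiv_const]
  simp [mul_comm]

theorem frameForm_change (ht : ∀ i, MDiffAt (T% (fun y => t y i)) x)
    (hs : ∀ i, MDiffAt (T% (fun y => s y i)) x) (v : TangentSpace I x) :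
    frameForm s x v = (Matrix.of fun i j => inner ℝ (t x i) (s x j)).transpose *
      (Matrix.of (fun i j => d% (fun y => inner ℝ (t y i) (s y j)) x v)
        + frameForm t x v * Matrix.of fun i j => inner ℝ (t x i) (s x j)) := by
  ext i j
  rw [frameForm, Matrix.of_apply, ← (t x).sum_inner_mul_inner, Matrix.mul_apply]
  refine Finset.sum_congr rfl fun k _ => ?_
  rw [inner_frame_leviCivita ht (hs j), Matrix.add_apply, Matrix.mul_apply, Matrix.transpose_apply,
    Matrix.of_apply, real_inner_comm]
  rfl

/-- The `𝔤⊥`-part of the connection form transforms tensorially under changes of frame by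
functions with values in `G`. -/
theorem projPerp_frameForm_change {G : Subgroup (SO n)} {K : Matrix (Fin n) (Fin n) ℝ} {ε : ℝ}
    (hK : IsSymmetricPair G K ε) (ht : ∀ i, MDiffAt (T% (fun y => t y i)) x)
    (hs : ∀ i, MDiffAt (T% (fun y => s y i)) x)
    (hG : ∀ᶠ y in nhds x, ∃ a ∈ G, ∀ j, s y j = ∑ i, (a : Matrix (Fin n) (Fin n) ℝ) i j • t y i)
    (v : TangentSpace I x) :
    projPerp G (frameForm s x v) = (Matrix.of fun i j => inner ℝ (t x i) (s x j)).transpose *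
      projPerp G (frameForm t x v) * Matrix.of fun i j => inner ℝ (t x i) (s x j) := by
  have hchange := frameForm_change ht hs v
  have hskew := frameForm_transpose ht v
  set a : M → Matrix (Fin n) (Fin n) ℝ := fun y => Matrix.of fun i j => inner ℝ (t y i) (s y j)
    with ha
  have had : ∀ i j, MDiffAt (fun y => a y i j) x := fun i j => mdifferentiableAt_inner (ht i) (hs j)
  have hcomm : ∀ᶠ y in nhds x, a y * K = K * a y := by
    filter_upwards [hG] with y hy
    obtain ⟨g, hg, hgs⟩ := hy
    have : a y = (g : Matrix (Fin n) (Fin n) ℝ) := by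
      ext i j
      simp [ha, hgs, inner_sum, inner_smul_right, orthonormal_iff_ite.1 (t y).orthonormal]
    rw [this]
    exact hK.commute g hg
  have horth : ∀ y i j, ∑ k, a y k i * a y k j = if i = j then 1 else 0 := by
    intro y i j
    rw [← orthonormal_iff_ite.1 (s y).orthonormal i j, ← (t y).sum_inner_mul_inner]
    refine Finset.sum_congr rfl fun k _ => ?_
    rw [real_inner_comm (t y k)]
    rfl
  set A := a x with hA
  set B : Matrix (Fin n) (Fin n) ℝ := Matrix.of fun i j => d% (fun y => a y i j) x v with hB
  change frameForm s x v = A.transpose * (B + frameForm t x v * A) at hchange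
  change _ = A.transpose * projPerp G (frameForm t x v) * A
  generalize frameForm t x v = η at *
  have hAK : A * K = K * A := hcomm.self_of_nhds
  -- This is the derivative of `a K = K a`, which holds near `x` since `a` takes values in `G`
  -- there.
  have hBK : B * K = K * B := by
    let L : Matrix (Fin n) (Fin n) ℝ →ₗ[ℝ] Matrix (Fin n) (Fin n) ℝ :=
      LinearMap.mulRight ℝ K - LinearMap.mulLeft ℝ K
    have hL : L B = 0 := by
      ext i j
      rw [hB, ← mvfderiv_linearMap_matrix L had i j v,
        mvfderiv_congr (g := fun _ => (0 : ℝ)) (by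
          filter_upwards [hcomm] with y hy
          simp [L, hy]), mvfderiv_const]
      rfl
    simpa [L, sub_eq_zero] using hL
  have hε : ε ≠ 0 := by rintro rfl; simpa using hK.sq_eq_one
  have hAtK : A.transpose * K = K * A.transpose := by
    have := congrArg Matrix.transpose hAK
    rw [Matrix.transpose_mul, Matrix.transpose_mul, hK.transpose_eq, smul_mul_assoc,
      mul_smul_comm] at this
    exact (smul_right_injective _ hε this).symm
  -- Differentiating `aᵀ a = 1` makes `aᵀ da` skew. As it also commutes with `K` it lies in 𝔤, so
  -- the inhomogeneous term of the gauge transformation has no 𝔤⊥-part.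
  have hABskew : (A.transpose * B).transpose = -(A.transpose * B) := by
    ext i j
    have h1 := mvfderiv_fun_sum_mul (f := fun k y => a y k j) (g := fun k y => a y k i) Finset.univ
      (fun k => had k j) (fun k => had k i) v
    rw [show (fun y => ∑ k, a y k j * a y k i) = fun _ => if j = i then (1 : ℝ) else 0 from
      funext fun y => horth y j i, mvfderiv_const, Finset.sum_add_distrib] at h1
    have h2 : (A.transpose * B) j i = ∑ k, a x k j * d% (fun y => a y k i) x v := by
      simp [Matrix.mul_apply, hB, hA]
    have h3 : (A.transpose * B) i j = ∑ k, a x k i * d% (fun y => a y k j) x v := by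
      simp [Matrix.mul_apply, hB, hA]
    rw [Matrix.transpose_apply, Matrix.neg_apply, h2, h3]
    simp at h1
    linarith
  have hηskew : (A.transpose * η * A).transpose = -(A.transpose * η * A) := by
    simp [Matrix.transpose_mul, hskew, mul_assoc]
  rw [hchange, mul_add, ← mul_assoc, map_add, hK.projPerp_eq_zero hABskew
    (by rw [mul_assoc, hBK, ← mul_assoc, hAtK, mul_assoc]), zero_add, hK.projPerp_eq hηskew,
    hK.projPerp_eq hskew]
  have h5 : K * (A.transpose * η * A) * K = A.transpose * (K * η * K) * A := by
    calc K * (A.transpose * η * A) * K = (K * A.transpose) * η * (A * K) := by noncomm_ring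
      _ = _ := by rw [← hAtK, hAK]; noncomm_ring
  rw [h5, mul_smul_comm, smul_mul_assoc, mul_sub, sub_mul, mul_smul_comm, smul_mul_assoc]

/-- The curvature matrix `Ω(v, w)` at `x` in an orthonormal frame. -/
def frameCurvature (s : ∀ y : M, OrthonormalBasis (Fin n) ℝ (TangentSpace I y)) (x : M)
    (v w : TangentSpace I x) : Matrix (Fin n) (Fin n) ℝ :=
  Matrix.of fun i j => inner ℝ (s x i) (curvature leviCivita x v w (s x j))

theorem frameCurvature_eq (hs : ∀ i, CMDiffAt 2 (T% (fun y => s y i)) x)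
    (v w : TangentSpace I x) : frameCurvature s x v w =
      (∑ b, (inner ℝ (s x b) w • frameFormDeriv s x v b
          - inner ℝ (s x b) v • frameFormDeriv s x w b))
        - (∑ b, (∑ m, (frameForm s x v b m * inner ℝ (s x m) w
          - frameForm s x w b m * inner ℝ (s x m) v)) • frameForm s x (s x b))
        + (frameForm s x v * frameForm s x w - frameForm s x w * frameForm s x v) := by
  ext k l
  rw [frameCurvature, Matrix.of_apply, inner_frame_curvature hs]
  simp [Matrix.sum_apply, Matrix.mul_apply, Finset.sum_sub_distrib]

theorem frameCurvature_swap (hs : ∀ i, CMDiffAt 2 (T% (fun y => s y i)) x)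
    (v w : TangentSpace I x) : frameCurvature s x v w = -frameCurvature s x w v := by
  rw [frameCurvature_eq hs, frameCurvature_eq hs]
  simp only [Finset.sum_sub_distrib, sub_smul]
  abel

/-- Although `curvature` is defined through chosen extensions, `frameCurvature_eq` involves only `v`
and `w`, and linearity is read off from it. -/
theorem isLinearMap_frameCurvature_left (hs : ∀ i, CMDiffAt 2 (T% (fun y => s y i)) x)
    (w : TangentSpace I x) : IsLinearMap ℝ fun v => frameCurvature s x v w where
  map_add v v' := by
    simp only [frameCurvature_eq hs, frameForm_add, frameFormDeriv_add, Finset.sum_sub_distrib,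
      inner_add_right, smul_add, add_smul, Finset.sum_add_distrib, Matrix.add_apply, add_mul,
      mul_add, sub_smul]
    abel
  map_smul c v := by
    simp only [frameCurvature_eq hs, frameForm_smul, frameFormDeriv_smul, Finset.sum_sub_distrib,
      inner_smul_right, Matrix.smul_apply, smul_mul_assoc, mul_smul_comm, sub_smul, smul_sub,
      smul_add, Finset.smul_sum, smul_smul, Finset.sum_smul, smul_eq_mul]
    simp only [mul_assoc, mul_left_comm, mul_comm]

theorem isLinearMap_frameCurvature_right (hs : ∀ i, CMDiffAt 2 (T% (fun y => s y i)) x)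
    (v : TangentSpace I x) : IsLinearMap ℝ fun w => frameCurvature s x v w where
  map_add w w' := by
    rw [frameCurvature_swap hs v, (isLinearMap_frameCurvature_left hs v).map_add,
      frameCurvature_swap hs v w, frameCurvature_swap hs v w', neg_add]
  map_smul c w := by
    rw [frameCurvature_swap hs v, (isLinearMap_frameCurvature_left hs v).map_smul,
      frameCurvature_swap hs v w, smul_neg]

theorem frameCurvature_frame (hs : ∀ i, CMDiffAt 2 (T% (fun y => s y i)) x) (i j : Fin n) :
    frameCurvature s x (s x i) (s x j) =
      frameFormDeriv s x (s x i) j - frameFormDeriv s x (s x j) i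
        - ∑ b, (frameForm s x (s x i) b j - frameForm s x (s x j) b i) • frameForm s x (s x b)
        + (frameForm s x (s x i) * frameForm s x (s x j)
          - frameForm s x (s x j) * frameForm s x (s x i)) := by
  rw [frameCurvature_eq hs]
  simp [orthonormal_iff_ite.1 (s x).orthonormal, Finset.sum_sub_distrib]

end Frame

/-! ### Intrinsic torsion, characteristic field and `s_{𝔤⊥}` in sections of `P`. -/

section GStructures

variable {n : ℕ} {M : Type*} [TopologicalSpace M] [ChartedSpace (EuclideanSpace ℝ (Fin n)) M]
  [IsManifold (𝓡 n) ∞ M] [RiemannianBundle (fun x : M => TangentSpace (𝓡 n) x)]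
  [IsContMDiffRiemannianBundle (𝓡 n) ∞ (EuclideanSpace ℝ (Fin n))
    (fun x : M => TangentSpace (𝓡 n) x)]

namespace GStructure

variable {o : ManifoldOrientation n M} {G : Subgroup (SO n)} (P : GStructure o G)

theorem intrinsicTorsion_add_left (x : M) (X X' Y : TangentSpace (𝓡 n) x) :
    P.intrinsicTorsion x (X + X') Y = P.intrinsicTorsion x X Y + P.intrinsicTorsion x X' Y :=
  map_add _ _ _

theorem intrinsicTorsion_smul_left (x : M) (c : ℝ) (X Y : TangentSpace (𝓡 n) x) :
    P.intrinsicTorsion x (c • X) Y = c • P.intrinsicTorsion x X Y :=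
  map_smul _ _ _

theorem intrinsicTorsion_add_right (x : M) (X Y Y' : TangentSpace (𝓡 n) x) :
    P.intrinsicTorsion x X (Y + Y') = P.intrinsicTorsion x X Y + P.intrinsicTorsion x X Y' := by
  simp [intrinsicTorsion]

theorem intrinsicTorsion_smul_right (x : M) (c : ℝ) (X Y : TangentSpace (𝓡 n) x) :
    P.intrinsicTorsion x X (c • Y) = c • P.intrinsicTorsion x X Y := by
  simp [intrinsicTorsion]

/-- The frame fields have constant components, so `∇^G` and `∇` act on them through `ω_𝔤` and `ω`
alone, and `ω_𝔤 - ω = -ω_{𝔤⊥}`. -/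
theorem inner_localFrame_intrinsicTorsion (x : M) (X : TangentSpace (𝓡 n) x) (i j : Fin n) :
    inner ℝ (P.localFrame x x i) (P.intrinsicTorsion x X (P.localFrame x x j))
      = -projPerp G (frameForm (P.localFrame x) x X) i j := by
  have h := P.intrinsicTorsion_apply X (Y := fun y => P.localFrame x y j)
    (P.mdifferentiableAt_localFrame x j)
  have hc : ∀ i, (fun y => inner ℝ (P.localFrame x y i) (P.localFrame x y j))
      = fun _ : M => (if i = j then 1 else 0 : ℝ) :=
    fun i => funext fun y => orthonormal_iff_ite.1 (P.localFrame x y).orthonormal i j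
  have hg : inner ℝ (P.localFrame x x i) (P.gConnection (fun y => P.localFrame x y j) x X)
      = projLie G (connectionForm (P.localFrame x) x X) i j := by
    simp only [gConnection, hc, mvfderiv_const]
    simp [inner_sum, inner_smul_right, orthonormal_iff_ite.1 (P.localFrame x x).orthonormal,
      connectionCoeff]
  rw [h, inner_sub_right, hg]
  have : projPerp G (frameForm (P.localFrame x) x X) i j
    = frameForm (P.localFrame x) x X i j - projLie G (frameForm (P.localFrame x) x X) i j := rfl
  rw [this]
  change _ - frameForm (P.localFrame x) x X i j = _
  change projLie G (frameForm (P.localFrame x) x X) i j - _ = _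
  ring

/-- In any local section of `P`, the intrinsic torsion is minus the `𝔤⊥`-part of the Levi-Civita
connection form. -/
theorem inner_intrinsicTorsion {K : Matrix (Fin n) (Fin n) ℝ} {ε : ℝ}
    (hK : IsSymmetricPair G K ε) {x : M}
    {s : ∀ y : M, OrthonormalBasis (Fin n) ℝ (TangentSpace (𝓡 n) y)}
    (hs : ∀ i, MDifferentiableAt (𝓡 n) ((𝓡 n).prod 𝓘(ℝ, EuclideanSpace ℝ (Fin n)))
      (fun y => (⟨y, s y i⟩ : TangentBundle (𝓡 n) M)) x)
    (hP : ∀ᶠ y in nhds x, s y ∈ P.frames y) (X : TangentSpace (𝓡 n) x) (i j : Fin n) :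
    inner ℝ (s x i) (P.intrinsicTorsion x X (s x j)) = -projPerp G (frameForm s x X) i j := by
  -- The torsion at `x` is built from the section chosen for `x`, while `s` may be the section
  -- chosen for a nearby point; the two differ by a `G`-valued function.
  set t := P.localFrame x with ht
  obtain ⟨U, hU, hxU, hUP, -⟩ := P.localFrame_spec x
  have hG : ∀ᶠ y in nhds x, ∃ a ∈ G,
      ∀ j, s y j = ∑ i, (a : Matrix (Fin n) (Fin n) ℝ) i j • t y i := by
    filter_upwards [hP, hU.mem_nhds hxU] with y hy hyU
    exact (P.orbit y (t y) (hUP y hyU) (s y)).1 hy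
  rw [projPerp_frameForm_change hK (P.mdifferentiableAt_localFrame x) hs hG X]
  have h1 : ∀ Z : TangentSpace (𝓡 n) x, inner ℝ (s x i) Z
      = ∑ k, inner ℝ (s x i) (t x k) * inner ℝ (t x k) Z := fun Z =>
    ((t x).sum_inner_mul_inner _ _).symm
  have h2 : ∀ k, inner ℝ (t x k) (P.intrinsicTorsion x X (s x j))
      = ∑ l, inner ℝ (t x l) (s x j) * inner ℝ (t x k) (P.intrinsicTorsion x X (t x l)) := by
    intro k
    have hlin : IsLinearMap ℝ fun Y => inner ℝ (t x k) (P.intrinsicTorsion x X Y) :=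
      { map_add := fun Y Y' => by rw [intrinsicTorsion_add_right, inner_add_right]
        map_smul := fun c Y => by rw [intrinsicTorsion_smul_right, inner_smul_right]; rfl }
    conv_lhs => rw [← (t x).sum_repr' (s x j)]
    refine (map_sum (IsLinearMap.mk' _ hlin) (fun l => inner ℝ (t x l) (s x j) • t x l) _).trans ?_
    exact Finset.sum_congr rfl fun l _ => hlin.map_smul _ _
  have h3 : ∀ k l, inner ℝ (t x k) (P.intrinsicTorsion x X (t x l))
      = -projPerp G (frameForm t x X) k l := P.inner_localFrame_intrinsicTorsion x X
  rw [h1]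
  simp only [h2, h3]
  rw [mul_assoc, Matrix.mul_apply, ← Finset.sum_neg_distrib]
  refine Finset.sum_congr rfl fun k _ => ?_
  rw [Matrix.mul_apply, Matrix.transpose_apply, Matrix.of_apply, real_inner_comm, ← mul_neg,
    ← Finset.sum_neg_distrib]
  congr 1
  refine Finset.sum_congr rfl fun l _ => ?_
  rw [Matrix.of_apply]
  ring

theorem localFrame_eventually (x : M) : ∀ᶠ y in nhds x,
    (∀ i, ContMDiffAt (𝓡 n) ((𝓡 n).prod 𝓘(ℝ, EuclideanSpace ℝ (Fin n))) 2
      (fun y => (⟨y, P.localFrame x y i⟩ : TangentBundle (𝓡 n) M)) y) ∧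
    ∀ᶠ z in nhds y, P.localFrame x z ∈ P.frames z := by
  obtain ⟨U, hU, hxU, hUP, hUs⟩ := P.localFrame_spec x
  filter_upwards [hU.mem_nhds hxU] with y hy
  refine ⟨fun i => ((hUs i).contMDiffAt (hU.mem_nhds hy)).of_le (by norm_cast), ?_⟩
  filter_upwards [hU.mem_nhds hy] with z hz using hUP z hz

/-- One fixed `s` may be used at all points near a given one, so that `χ = 0` becomes an identity of
functions that can be differentiated. -/
theorem inner_charField {K : Matrix (Fin n) (Fin n) ℝ} {ε : ℝ}
    (hK : IsSymmetricPair G K ε) {x : M}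
    {s : ∀ y : M, OrthonormalBasis (Fin n) ℝ (TangentSpace (𝓡 n) y)}
    (hs : ∀ i, MDifferentiableAt (𝓡 n) ((𝓡 n).prod 𝓘(ℝ, EuclideanSpace ℝ (Fin n)))
      (fun y => (⟨y, s y i⟩ : TangentBundle (𝓡 n) M)) x)
    (hP : ∀ᶠ y in nhds x, s y ∈ P.frames y) (k : Fin n) :
    inner ℝ (s x k) (P.charField x) = -∑ b, projPerp G (frameForm s x (s x b)) k b := by
  rw [charField, inner_sum]
  refine (sum_bilinear_orthonormalBasis (stdOrthonormalBasis ℝ (TangentSpace (𝓡 n) x)) (s x)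
    (fun X Y => inner ℝ (s x k) (P.intrinsicTorsion x X Y)) (fun Y => ⟨fun X X' => ?_, fun c X => ?_⟩)
    (fun X => ⟨fun Y Y' => ?_, fun c Y => ?_⟩)).trans ?_
  · rw [intrinsicTorsion_add_left, inner_add_right]
  · rw [intrinsicTorsion_smul_left, inner_smul_right]; rfl
  · rw [intrinsicTorsion_add_right, inner_add_right]
  · rw [intrinsicTorsion_smul_right, inner_smul_right]; rfl
  · rw [← Finset.sum_neg_distrib]
    exact Finset.sum_congr rfl fun b _ => P.inner_intrinsicTorsion hK hs hP _ _ _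

theorem scalarPerp_eq (x : M) :
    P.scalarPerp x = ∑ i, ∑ j, projPerp G
      (frameCurvature (P.localFrame x) x (P.localFrame x x i) (P.localFrame x x j)) i j := by
  set s := P.localFrame x with hs
  set e := stdOrthonormalBasis ℝ (TangentSpace (𝓡 n) x)
  have hsm := (P.localFrame_eventually x).self_of_nhds.1
  have haddl : ∀ v v' w, frameCurvature s x (v + v') w
      = frameCurvature s x v w + frameCurvature s x v' w :=
    fun v v' w => (isLinearMap_frameCurvature_left hsm w).map_add v v'
  have hsmull : ∀ (c : ℝ) v w, frameCurvature s x (c • v) w = c • frameCurvature s x v w :=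
    fun c v w => (isLinearMap_frameCurvature_left hsm w).map_smul c v
  have haddr : ∀ v w w', frameCurvature s x v (w + w')
      = frameCurvature s x v w + frameCurvature s x v w' :=
    fun v w w' => (isLinearMap_frameCurvature_right hsm v).map_add w w'
  have hsmulr : ∀ (c : ℝ) v w, frameCurvature s x v (c • w) = c • frameCurvature s x v w :=
    fun c v w => (isLinearMap_frameCurvature_right hsm v).map_smul c w
  -- Separating the four slots lets the two contractions, over `w, z` and over `v, z'`, change basis
  -- one at a time.
  let T : TangentSpace (𝓡 n) x → TangentSpace (𝓡 n) x → TangentSpace (𝓡 n) x →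
      TangentSpace (𝓡 n) x → ℝ := fun v w z z' =>
    inner ℝ (Matrix.toLin (s x).toBasis (s x).toBasis (projPerp G (frameCurvature s x v w)) z) z'
  have hT1 : ∀ w z z', IsLinearMap ℝ fun v => T v w z z' := fun w z z' =>
    { map_add := fun v v' => by
        simp only [T, haddl, map_add,
          LinearMap.add_apply, inner_add_left]
      map_smul := fun c v => by
        simp only [T, hsmull, map_smul,
          LinearMap.smul_apply, real_inner_smul_left, smul_eq_mul] }
  have hT2 : ∀ v z z', IsLinearMap ℝ fun w => T v w z z' := fun v z z' =>
    { map_add := fun w w' => by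
        simp only [T, haddr, map_add,
          LinearMap.add_apply, inner_add_left]
      map_smul := fun c w => by
        simp only [T, hsmulr, map_smul,
          LinearMap.smul_apply, real_inner_smul_left, smul_eq_mul] }
  have hT3 : ∀ v w z', IsLinearMap ℝ fun z => T v w z z' := fun v w z' =>
    { map_add := fun z y => by simp only [T, map_add, inner_add_left]
      map_smul := fun c z => by simp only [T, map_smul, real_inner_smul_left, smul_eq_mul] }
  have hT4 : ∀ v w z, IsLinearMap ℝ (T v w z) := fun v w z =>
    { map_add := fun z y => by simp only [T, inner_add_right]
      map_smul := fun c z => by simp only [T, real_inner_smul_right, smul_eq_mul] }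
  have h0 : P.scalarPerp x = ∑ i, ∑ j, T (e i) (e j) (e j) (e i) := rfl
  have h1 : ∀ v z', ∑ j, T v (e j) (e j) z' = ∑ j, T v (s x j) (s x j) z' := fun v z' =>
    sum_bilinear_orthonormalBasis e (s x) (fun w z => T v w z z') (fun z => hT2 v z z')
      (fun w => hT3 v w z')
  have h2 : ∀ w z, ∑ i, T (e i) w z (e i) = ∑ i, T (s x i) w z (s x i) := fun w z =>
    sum_bilinear_orthonormalBasis e (s x) (fun v z' => T v w z z') (fun z' => hT1 w z z')
      (fun v => hT4 v w z)
  rw [h0]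
  simp only [h1]
  rw [Finset.sum_comm]
  simp only [h2]
  rw [Finset.sum_comm]
  refine Finset.sum_congr rfl fun i _ => Finset.sum_congr rfl fun j _ => ?_
  have h3 : ∀ k, s x k = (s x).toBasis k := fun k => by simp
  simp only [T]
  rw [h3 j, Matrix.toLin_self]
  simp [sum_inner, real_inner_smul_left, orthonormal_iff_ite.1 (s x).orthonormal]

/-- Polarisation, `|u - v|² - |u + v|² = -4 ⟨u, v⟩`, leaves `-∑ g(ξ_{e_i} e_j, ξ_{e_j} e_i)`, which
is then expanded in the frame. -/
theorem normSq_torsionAlt_sub_normSq_torsionSym {K : Matrix (Fin n) (Fin n) ℝ} {ε : ℝ}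
    (hK : IsSymmetricPair G K ε) (x : M) :
    normSq (P.torsionAlt x) - normSq (P.torsionSym x) = -∑ i, ∑ j, ∑ k,
      projPerp G (frameForm (P.localFrame x) x (P.localFrame x x i)) k j *
        projPerp G (frameForm (P.localFrame x) x (P.localFrame x x k)) i j := by
  set s := P.localFrame x with hs
  set e := stdOrthonormalBasis ℝ (TangentSpace (𝓡 n) x)
  have h0 : normSq (P.torsionAlt x) - normSq (P.torsionSym x)
      = -∑ i, ∑ j, inner ℝ (P.intrinsicTorsion x (e i) (e j)) (P.intrinsicTorsion x (e j) (e i)) := by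
    simp only [normSq, ← Finset.sum_sub_distrib, ← Finset.sum_neg_distrib]
    refine Finset.sum_congr rfl fun i _ => Finset.sum_congr rfl fun j _ => ?_
    rw [torsionAlt, torsionSym, norm_smul, norm_smul, mul_pow, mul_pow, norm_sub_sq_real,
      norm_add_sq_real, Real.norm_eq_abs, sq_abs]
    ring
  have h1 : ∀ v, ∑ j, inner ℝ (P.intrinsicTorsion x v (e j)) (P.intrinsicTorsion x (e j) v)
      = ∑ j, inner ℝ (P.intrinsicTorsion x v (s x j)) (P.intrinsicTorsion x (s x j) v) := fun v =>
    sum_bilinear_orthonormalBasis e (s x)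
      (fun w z => inner ℝ (P.intrinsicTorsion x v w) (P.intrinsicTorsion x z v))
      (fun z => ⟨fun w w' => by rw [intrinsicTorsion_add_right, inner_add_left],
        fun c w => by rw [intrinsicTorsion_smul_right, real_inner_smul_left]; rfl⟩)
      (fun w => ⟨fun z z' => by rw [intrinsicTorsion_add_left, inner_add_right],
        fun c z => by rw [intrinsicTorsion_smul_left, real_inner_smul_right]; rfl⟩)
  have h2 : ∀ w, ∑ i, inner ℝ (P.intrinsicTorsion x (e i) w) (P.intrinsicTorsion x w (e i))
      = ∑ i, inner ℝ (P.intrinsicTorsion x (s x i) w) (P.intrinsicTorsion x w (s x i)) := fun w =>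
    sum_bilinear_orthonormalBasis e (s x)
      (fun v z => inner ℝ (P.intrinsicTorsion x v w) (P.intrinsicTorsion x w z))
      (fun z => ⟨fun v v' => by rw [intrinsicTorsion_add_left, inner_add_left],
        fun c v => by rw [intrinsicTorsion_smul_left, real_inner_smul_left]; rfl⟩)
      (fun v => ⟨fun z z' => by rw [intrinsicTorsion_add_right, inner_add_right],
        fun c z => by rw [intrinsicTorsion_smul_right, real_inner_smul_right]; rfl⟩)
  have h3 : ∀ X k l, inner ℝ (s x k) (P.intrinsicTorsion x X (s x l))
      = -projPerp G (frameForm s x X) k l := P.inner_localFrame_intrinsicTorsion x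
  rw [h0]
  simp only [h1]
  rw [Finset.sum_comm]
  simp only [h2]
  rw [Finset.sum_comm]
  congr 1
  refine Finset.sum_congr rfl fun i _ => ?_
  rw [Finset.sum_comm]
  have hsd := P.mdifferentiableAt_localFrame x
  -- Skewness is used once in each factor, to match the index order of `sum_projPerp_curvature`; the
  -- signs cancel.
  have hβ : ∀ X k l, projPerp G (frameForm s x X) k l = -projPerp G (frameForm s x X) l k :=
    fun X k l => congrFun (congrFun (hK.transpose_projPerp (frameForm_transpose hsd X)) l) k
  refine Finset.sum_congr rfl fun j _ => ?_
  rw [← (s x).sum_inner_mul_inner]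
  refine Finset.sum_congr rfl fun k _ => ?_
  rw [real_inner_comm, h3, h3, hβ _ j k, hβ _ i k]

/-- The scalar curvature component in terms of the intrinsic torsion, for vanishing characteristic
vector field. -/
theorem half_scalarPerp_eq {K : Matrix (Fin n) (Fin n) ℝ} {ε : ℝ}
    (hK : IsSymmetricPair G K ε) (hχ : ∀ x, P.charField x = 0) (x : M) :
    (1 / 2) * P.scalarPerp x = normSq (P.torsionAlt x) - normSq (P.torsionSym x) := by
  set s := P.localFrame x with hs
  have hev := P.localFrame_eventually x
  have hsm : ∀ i, ContMDiffAt (𝓡 n) ((𝓡 n).prod 𝓘(ℝ, EuclideanSpace ℝ (Fin n))) 2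
      (fun y => (⟨y, s y i⟩ : TangentBundle (𝓡 n) M)) x := hev.self_of_nhds.1
  have hsd := fun i => (hsm i).mdifferentiableAt (by simp)
  -- Vanishing of `χ` at `x` alone would not do: `h1` below is the derivative of this identity.
  have hχ' : ∀ k, ∀ᶠ y in nhds x, ∑ b, projPerp G (frameForm s y (s y b)) k b = 0 := by
    intro k
    filter_upwards [hev] with y hy
    have := P.inner_charField hK (fun i => (hy.1 i).mdifferentiableAt (by simp)) hy.2 k
    rw [hχ, inner_zero_right] at this
    exact neg_eq_zero.1 this.symm
  have h1 : ∀ i k, ∑ b, projPerp G (frameFormDeriv s x (s x i) b) k b = 0 := by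
    intro i k
    have hd : ∀ b, MDifferentiableAt (𝓡 n) 𝓘(ℝ, ℝ)
        (fun y => projPerp G (frameForm s y (s y b)) k b) x := fun b =>
      mdifferentiableAt_linearMap_matrix _ (fun p q => mdifferentiableAt_frameForm hsm b p q) k b
    have h2 := mvfderiv_congr (I := 𝓡 n) (g := fun _ => (0 : ℝ)) (hχ' k)
    rw [mvfderiv_const, mvfderiv_fun_sum _ fun b _ => hd b] at h2
    have h3 := congrArg (fun L : TangentSpace (𝓡 n) x →L[ℝ] ℝ => L (s x i)) h2
    simp only [_root_.sum_apply, _root_.zero_apply] at h3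
    rw [← h3]
    refine Finset.sum_congr rfl fun b _ => ?_
    exact (mvfderiv_linearMap_matrix _ (fun p q => mdifferentiableAt_frameForm hsm b p q) k b _).symm
  have key := sum_projPerp_curvature hK (fun i => frameForm s x (s x i))
    (fun i b => frameFormDeriv s x (s x i) b) (fun i => frameForm_transpose hsd _)
    (fun i b => frameFormDeriv_transpose hsm _ _) (fun k => (hχ' k).self_of_nhds) h1
  rw [P.normSq_torsionAlt_sub_normSq_torsionSym hK, P.scalarPerp_eq]
  simp only [← hs, frameCurvature_frame hsm]
  rw [key]
  ring

end GStructure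

end GStructures

theorem exists_isSymmetricPair {n : ℕ} {G : Subgroup (SO n)}
    (hG : (∃ (k : ℕ) (h : k + k = n), G = unitarySubgroup h) ∨
      ∃ (m l : ℕ) (h : m + l = n), G = productSubgroup h) :
    ∃ (K : Matrix (Fin n) (Fin n) ℝ) (ε : ℝ), IsSymmetricPair G K ε := by
  obtain ⟨k, h, rfl⟩ | ⟨m, l, h, rfl⟩ := hG
  · exact ⟨_, _, isSymmetricPair_unitarySubgroup h⟩
  · exact ⟨_, _, isSymmetricPair_productSubgroup h⟩

end

end GStr

theorem mainTheorem3 {n : ℕ} {M : Type*} [TopologicalSpace M]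
    [ChartedSpace (EuclideanSpace ℝ (Fin n)) M] [IsManifold (𝓡 n) ∞ M]
    [RiemannianBundle (fun x : M => TangentSpace (𝓡 n) x)]
    [IsContMDiffRiemannianBundle (𝓡 n) ∞ (EuclideanSpace ℝ (Fin n))
      (fun x : M => TangentSpace (𝓡 n) x)]
    (o : GStr.ManifoldOrientation n M) (G : Subgroup (GStr.SO n))
    (hG : (∃ (k : ℕ) (h : k + k = n), G = GStr.unitarySubgroup h) ∨
      ∃ (m l : ℕ) (h : m + l = n), G = GStr.productSubgroup h)
    (P : GStr.GStructure o G) :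
    ((∀ x, P.charField x = 0) →
      ∀ x, (1 / 2) * P.scalarPerp x
        = GStr.normSq (P.torsionAlt x) - GStr.normSq (P.torsionSym x)) ∧
    (P.IsTotallySkew →
      (∀ x, P.scalarPerp x = 2 * GStr.normSq (P.intrinsicTorsion x) ∧ 0 ≤ P.scalarPerp x ∧
        (P.scalarPerp x = 0 ↔ ∀ X Y, P.intrinsicTorsion x X Y = 0)) ∧
      ((∀ x, P.scalarPerp x = 0) ↔ P.IsIntegrable)) := by
  obtain ⟨K, ε, hK⟩ := GStr.exists_isSymmetricPair hG
  refine ⟨fun hχ x => P.half_scalarPerp_eq hK hχ x, fun hskew => ?_⟩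
  -- Skewness in `X, Y` gives `ξ_X X = 0`, hence `χ = 0`, so (a) applies with `ξ^sym = 0` and `ξ^alt
  -- = ξ`.
  have hswap : ∀ (x : M) (X Y : TangentSpace (𝓡 n) x),
      P.intrinsicTorsion x X Y = -P.intrinsicTorsion x Y X := fun x X Y =>
    ext_inner_right ℝ fun Z => by rw [inner_neg_left]; exact (hskew x X Y Z).1
  have hχ : ∀ x, P.charField x = 0 := fun x =>
    Finset.sum_eq_zero fun i _ => by
      have h := hswap x (stdOrthonormalBasis ℝ (TangentSpace (𝓡 n) x) i)
        (stdOrthonormalBasis ℝ (TangentSpace (𝓡 n) x) i)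
      rw [eq_neg_iff_add_eq_zero, ← two_smul ℝ, smul_eq_zero] at h
      exact h.resolve_left two_ne_zero
  have hscal : ∀ x, P.scalarPerp x = 2 * GStr.normSq (P.intrinsicTorsion x) := by
    intro x
    have halt : P.torsionAlt x = P.intrinsicTorsion x := by
      funext X Y
      rw [GStr.GStructure.torsionAlt, hswap x Y X, sub_neg_eq_add, ← two_smul ℝ, smul_smul]
      norm_num
    have hsym : GStr.normSq (P.torsionSym x) = 0 := by
      refine Finset.sum_eq_zero fun i _ => Finset.sum_eq_zero fun j _ => ?_
      rw [GStr.GStructure.torsionSym, hswap x, neg_add_cancel]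
      simp
    have := P.half_scalarPerp_eq hK hχ x
    rw [halt, hsym] at this
    linarith
  have hnonneg : ∀ x, 0 ≤ GStr.normSq (P.intrinsicTorsion x) := fun x =>
    Finset.sum_nonneg fun i _ => Finset.sum_nonneg fun j _ => sq_nonneg _
  have hzero : ∀ x, P.scalarPerp x = 0 ↔ ∀ X Y, P.intrinsicTorsion x X Y = 0 := by
    intro x
    rw [hscal]
    refine ⟨fun h => ?_, fun h => by simp [GStr.normSq, h]⟩
    have h0 : GStr.normSq (P.intrinsicTorsion x) = 0 := by linarith
    have hb : ∀ i j, P.intrinsicTorsion x (stdOrthonormalBasis ℝ (TangentSpace (𝓡 n) x) i)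
        (stdOrthonormalBasis ℝ (TangentSpace (𝓡 n) x) j) = 0 := by
      intro i j
      have h1 := (Finset.sum_eq_zero_iff_of_nonneg fun i _ =>
        Finset.sum_nonneg fun j _ => sq_nonneg _).1 h0 i (Finset.mem_univ i)
      have h2 := (Finset.sum_eq_zero_iff_of_nonneg fun j _ => sq_nonneg _).1 h1 j
        (Finset.mem_univ j)
      exact norm_eq_zero.1 (pow_eq_zero_iff two_ne_zero |>.1 h2)
    -- A zero norm gives `ξ = 0` only on pairs of basis vectors; bilinearity extends this to all `X,
    -- Y`.
    have hL : (P.gConnection.difference GStr.leviCivita x).toLinearMap = 0 := by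
      refine (stdOrthonormalBasis ℝ (TangentSpace (𝓡 n) x)).toBasis.ext fun j => ?_
      refine ContinuousLinearMap.coe_injective ?_
      refine (stdOrthonormalBasis ℝ (TangentSpace (𝓡 n) x)).toBasis.ext fun i => ?_
      simpa [GStr.GStructure.intrinsicTorsion] using hb i j
    intro X Y
    have := congrArg (fun L => L Y X) hL
    exact this
  exact ⟨fun x => ⟨hscal x, by rw [hscal]; linarith [hnonneg x], hzero x⟩,
    forall_congr' hzero⟩
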